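/- Let $k\ge 1$ and let $A=[\alpha_1,\dots,\alpha_k]$ be a non-descending sequence of positive rational numbers with $\sum_{j=1}^k\alpha_j=1$. Put $A_j=\alpha_1+\dots+\alpha_j$, and suppose that $$\mathrm{slack}(A)=\min_{1\le j<k}\Big(A_j\big(1-\tfrac{A_j}{2}\big)-\tfrac{j}{2k}\Big)>0$$ (for $k=1$ this condition is vacuous). Then there are $\delta>0$ and $N\in\mathbb N$, depending only on $A$, such that the following holds for every positive integer $n\ge N$ for which $s=\frac{n(n+1)}{2k}$ and all $\alpha_jn$, $1\le j\le k$, are integers. In the algorithm $\mathcal R$ below, the call of $\mathcal F$ terminates and its result $(x_{i,j})$ satisfies $x_{i,j}\ge 0$ and $\sum_j x_{i,j}=1$ for all $i$, so that the random choices in $\mathcal R$ are well defined. With probability at least $1-e^{-\delta n}$ these random choices are such that $\mathcal R$, in whatever way the choices left open in its two loops are made, terminates and returns a partition $Q_1\sqcup\dots\sqcup Q_k=[n]$ with $|Q_j|=\alpha_jn$ and $S(Q_j)=s$ for all $j$, where $S(Q)=\sum_{z\in Q}z$. In other words, $\mathcal R$ fails to solve the problem with probability at most $e^{-\delta n}$.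 **Algorithm $\mathcal R$ (randomized rounding).** (1) Let $a_i=n-i+1$, $u_i=1$ for $i\in[n]$, and $b_j=s$, $v_j=\alpha_jn$ for $j\in[k]$. Let $(x_{i,j})_{i\in[n],j\in[k]}=\mathcal F(a,u,b,v)$. (2) Choose $X_1,\dots,X_n\in[k]$ independently at random with $\Pr[X_i=j]=x_{i,j}$, and let $Q_j=\{n-i+1: X_i=j\}$. (3) While there are $j',j''$ with $|Q_{j'}|>\alpha_{j'}n$ and $|Q_{j''}|<\alpha_{j''}n$: choose such $j',j''$ and some $z\in Q_{j'}$, and move $z$ from $Q_{j'}$ to $Q_{j''}$. (4) While $S(Q_j)\ne s$ for some $j$: let $j'$ be an index maximizing $S(Q_j)$, let $j''$ be an index minimizing $S(Q_j)$, and let $\Delta=\min(S(Q_{j'})-s,\ s-S(Q_{j''}))$. If there are $z'\in Q_{j'}$ and $z''\in Q_{j''}$ with $0<z'-z''\le\Delta$, choose such $z',z''$ with $z'-z''$ maximal and exchange them between $Q_{j'}$ and $Q_{j''}$. Otherwise return Failure. (5) Return $Q_1,\dots,Q_k$. **Algorithm $\mathcal F$ (recursive).** The input is $(a,u,b,v)$,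 where $a,u$ have a common length $m$ and $b,v$ have a common length $l$. The output is an $m\times l$ matrix. Let $\delta_1$ be the row $(1,0,\dots,0)$. The first of the following cases that applies is executed. (i) If $l=1$, return the all-ones matrix. (ii) If $u_1=0$, delete the first entries of $a$ and $u$, apply $\mathcal F$ to the result, and return the matrix so obtained with the row $\delta_1$ put on top. (iii) If $v_1=0$, delete the first entries of $b$ and $v$, apply $\mathcal F$ to the result, and return the matrix so obtained with a zero column put in front. (iv) If $b_1/v_1=b_2/v_2$, put $\gamma=v_1/(v_1+v_2)$, let $X'=\mathcal F\big(a,u,(b_1+b_2,b_3,\dots,b_l),(v_1+v_2,v_3,\dots,v_l)\big)$, and return $X'$ with its first column $c$ replaced by the two columns $\gamma c$, $(1-\gamma)c$. (v) Otherwise put $\lambda=\min\Big(1,\frac{v_1}{u_1},\frac{b_1v_2-v_1b_2}{a_1v_2-u_1b_2}\Big)$, let $X'$ be the result of $\mathcal F$ on the input in which $a_1,u_1,b_1,v_1$ are replaced by $a_1-\lambda a_1$, $u_1-\lambda u_1$, $b_1-\lambda a_1$, $v_1-\lambda u_1$, and return $X'$ with its first row $r$ replaced by $\lambda\delta_1+(1-\lambda)r$.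 -/

import Mathlib

namespace EqualSumPartition

/-! ### Linear partition families -/

/-- `A_j = α_1 + ⋯ + α_j`. -/
def partialSum {k : ℕ} (α : Fin k → ℚ) (j : ℕ) : ℚ :=
  ∑ i : Fin k with i.val < j, α i

/-- `slack_j(A) = A_j (1 - A_j / 2) - j / (2k)`. -/
def slackAt {k : ℕ} (α : Fin k → ℚ) (j : ℕ) : ℚ :=
  partialSum α j * (1 - partialSum α j / 2) - (j : ℚ) / (2 * (k : ℚ))

/-- `slack(A) = min_{1 ≤ j < k} slack_j(A)`; the minimum of the empty family (`k = 1`) is `⊤`. -/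
def slack {k : ℕ} (α : Fin k → ℚ) : WithTop ℚ :=
  (Finset.Ico 1 k).inf fun j => ((slackAt α j : ℚ) : WithTop ℚ)

/-- The sequences `α_1, …, α_k` that define a linear partition problem family. -/
structure IsLinearFamily {k : ℕ} (α : Fin k → ℚ) : Prop where
  mono : Monotone α
  pos : ∀ j, 0 < α j
  sum_eq_one : ∑ j, α j = 1
  slack_pos : 0 < slack α

/-- `n` is the size of a member of the family of `α`: `n` is positive, the common sum
`n (n + 1) / (2k)` is an integer, and all part sizes `α_j n` are integers. -/
structure IsMember {k : ℕ} (α : Fin k → ℚ) (n : ℕ) : Prop where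
  pos : 0 < n
  dvd : k ∣ n * (n + 1) / 2
  integral : ∀ j, ∃ p : ℕ, α j * (n : ℚ) = (p : ℚ)

/-- The target sum `s^{n,k} = n (n + 1) / (2k)`. -/
noncomputable def targetSum (n k : ℕ) : ℝ :=
  (n : ℝ) * ((n : ℝ) + 1) / (2 * (k : ℝ))

/-! ### The fluid mixing problem and its recursive solution -/

/-- The data of a fluid mixing problem: source container `i` has mass `a i` and volume `u i`,
target container `j` has mass `b j` and volume `v j`. -/
structure FluidProblem (n k : ℕ) where
  a : Fin n → ℝ
  u : Fin n → ℝ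
  b : Fin k → ℝ
  v : Fin k → ℝ

/-- The recursive algorithm for the fluid mixing problem, run with recursion depth at most `depth`.
The value is `none` if this depth does not suffice, and also if the recursion arrives at a problem
without target containers, or with two or more target containers and no source container (there
the containers that the algorithm inspects do not exist). Indices start at `0`. -/
noncomputable def fluidMixingSolve :
    (depth n k : ℕ) → FluidProblem n k → Option (Fin n → Fin k → ℝ)
  | _ + 1, _, 1, _ => some (fun _ _ => 1)
  | depth + 1, n + 1, k + 2, π =>
    if π.u 0 = 0 then do
      -- null source container
      let X' ← fluidMixingSolve depth n (k + 2)
        { a := Fin.tail π.a, u := Fin.tail π.u, b := π.b, v := π.v }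
      return Fin.cons (Pi.single 0 1) X'
    else if π.v 0 = 0 then do
      -- null target container
      let X' ← fluidMixingSolve depth (n + 1) (k + 1)
        { a := π.a, u := π.u, b := Fin.tail π.b, v := Fin.tail π.v }
      return fun i => Fin.cons 0 (X' i)
    else if π.b 0 / π.v 0 = π.b 1 / π.v 1 then do
      -- merge the first two target containers
      let γ := π.v 0 / (π.v 0 + π.v 1)
      let X' ← fluidMixingSolve depth (n + 1) (k + 1)
        { a := π.a
          u := π.u
          b := Fin.cons (π.b 0 + π.b 1) (Fin.tail (Fin.tail π.b))
          v := Fin.cons (π.v 0 + π.v 1) (Fin.tail (Fin.tail π.v)) }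
      return fun i =>
        Fin.cons (γ * X' i 0) (Fin.cons ((1 - γ) * X' i 0) (Fin.tail (X' i)))
    else do
      -- pour from the first source container to the first target container
      let lam := min 1 (min (π.v 0 / π.u 0)
        ((π.b 0 * π.v 1 - π.v 0 * π.b 1) / (π.a 0 * π.v 1 - π.u 0 * π.b 1)))
      let X' ← fluidMixingSolve depth (n + 1) (k + 2)
        { a := Function.update π.a 0 (π.a 0 - lam * π.a 0)
          u := Function.update π.u 0 (π.u 0 - lam * π.u 0)
          b := Function.update π.b 0 (π.b 0 - lam * π.a 0)
          v := Function.update π.v 0 (π.v 0 - lam * π.u 0) }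
      return Function.update X' 0
        (fun j => lam * (Pi.single 0 1 : Fin (k + 2) → ℝ) j + (1 - lam) * X' 0 j)
  | _, _, _, _ => none

/-- The recursive algorithm, run on `π` without a bound on the depth of its recursion, terminates
and returns `x`. -/
def FluidMixingReturns {n k : ℕ} (π : FluidProblem n k) (x : Fin n → Fin k → ℝ) : Prop :=
  ∃ depth : ℕ, fluidMixingSolve depth n k π = some x

/-- A larger bound on the recursion depth does not change a result. -/
theorem fluidMixingSolve_succ (depth n k : ℕ) (π : FluidProblem n k)
    (x : Fin n → Fin k → ℝ) (h : fluidMixingSolve depth n k π = some x) :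
    fluidMixingSolve (depth + 1) n k π = some x := by
  induction depth generalizing n k with
  | zero => simp [fluidMixingSolve] at h
  | succ d ih =>
    match n, k, π, x, h with
    | _, 0, _, _, h => simp [fluidMixingSolve] at h
    | _, 1, _, _, h => simpa [fluidMixingSolve] using h
    | 0, _ + 2, _, _, h => simp [fluidMixingSolve] at h
    | n + 1, k + 2, π, x, h =>
      rw [fluidMixingSolve] at h ⊢
      by_cases h1 : π.u 0 = 0
      · rw [if_pos h1] at h ⊢
        obtain ⟨X', hX, hx⟩ := Option.bind_eq_some_iff.mp h
        exact Option.bind_eq_some_iff.mpr ⟨X', ih _ _ _ _ hX, hx⟩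
      rw [if_neg h1] at h ⊢
      by_cases h2 : π.v 0 = 0
      · rw [if_pos h2] at h ⊢
        obtain ⟨X', hX, hx⟩ := Option.bind_eq_some_iff.mp h
        exact Option.bind_eq_some_iff.mpr ⟨X', ih _ _ _ _ hX, hx⟩
      rw [if_neg h2] at h ⊢
      by_cases h3 : π.b 0 / π.v 0 = π.b 1 / π.v 1
      · rw [if_pos h3] at h ⊢
        obtain ⟨X', hX, hx⟩ := Option.bind_eq_some_iff.mp h
        exact Option.bind_eq_some_iff.mpr ⟨X', ih _ _ _ _ hX, hx⟩
      rw [if_neg h3] at h ⊢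
      obtain ⟨X', hX, hx⟩ := Option.bind_eq_some_iff.mp h
      exact Option.bind_eq_some_iff.mpr ⟨X', ih _ _ _ _ hX, hx⟩

/-- The result of the recursive algorithm is unique. -/
theorem FluidMixingReturns.unique {n k : ℕ} {π : FluidProblem n k}
    {x y : Fin n → Fin k → ℝ} (hx : FluidMixingReturns π x)
    (hy : FluidMixingReturns π y) : x = y := by
  obtain ⟨d, hd⟩ := hx
  obtain ⟨e, he⟩ := hy
  have key : ∀ (c m : ℕ) (z : Fin n → Fin k → ℝ),
      fluidMixingSolve m n k π = some z → fluidMixingSolve (m + c) n k π = some z := by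
    intro c m z hz
    induction c with
    | zero => exact hz
    | succ c ih => exact fluidMixingSolve_succ _ _ _ _ _ ih
  have h1 := key e d x hd
  have h2 := key d e y he
  rw [Nat.add_comm] at h2
  exact Option.some.inj (h1.symm.trans h2)

/-- The fluid mixing problem `a_i = n - i + 1`, `u_i = 1`, `b_j = s^{n,k}`, `v_j = α_j n` of a
partition problem. The `Fin` index `i` stands for `i + 1`, so the mass is `n - i`. -/
noncomputable def partitionProblem {k : ℕ} (α : Fin k → ℚ) (n : ℕ) : FluidProblem n k where
  a := fun i => (n : ℝ) - (i.val : ℝ)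
  u := fun _ => 1
  b := fun _ => targetSum n k
  v := fun j => (α j : ℝ) * (n : ℝ)

/-! ### Randomized rounding -/

/-- The law of the independent random choices `X_i` with `Pr[X_i = j] = x_{i,j}`. -/
noncomputable def roundingLaw {n k : ℕ} (x : Fin n → Fin k → ℝ) :
    MeasureTheory.Measure (Fin n → Fin k) :=
  MeasureTheory.Measure.pi fun i =>
    ∑ j, ENNReal.ofReal (x i j) • MeasureTheory.Measure.dirac j

/-- The sets `Q_j = {n - i + 1 : X_i = j}`; the `Fin` index `i` stands for `i + 1`. -/
def initialSets {n k : ℕ} (X : Fin n → Fin k) : Fin k → Finset ℕ :=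
  fun j => (Finset.univ.filter fun i => X i = j).image fun i => n - i.val

/-- `S(Q)`, the sum of the elements of `Q`. -/
def setSum (Q : Finset ℕ) : ℝ := ((∑ z ∈ Q, z : ℕ) : ℝ)

/-- Configurations of the randomized rounding algorithm after the random choices: it is in the
first while loop, in the second while loop, has returned sets, or has returned Failure. -/
inductive Config (k : ℕ) where
  | sizing (Q : Fin k → Finset ℕ)
  | balancing (Q : Fin k → Finset ℕ)
  | returned (Q : Fin k → Finset ℕ)
  | failure

/-- Parts `j'` and `j''` that the first while loop may choose. -/
def SizePair {k : ℕ} (α : Fin k → ℚ) (n : ℕ) (Q : Fin k → Finset ℕ) (j' j'' : Fin k) : Prop :=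
  (α j' : ℝ) * (n : ℝ) < ((Q j').card : ℝ) ∧ ((Q j'').card : ℝ) < (α j'' : ℝ) * (n : ℝ)

/-- Parts `j'` and `j''` that the second while loop may choose: `j'` is an argmax and `j''` an
argmin of the sums. -/
def SumPair {k : ℕ} (Q : Fin k → Finset ℕ) (j' j'' : Fin k) : Prop :=
  (∀ j, setSum (Q j) ≤ setSum (Q j')) ∧ ∀ j, setSum (Q j'') ≤ setSum (Q j)

/-- Elements `z'` and `z''` with `0 < z' - z'' ≤ Δ`, where
`Δ = min (S(Q_{j'}) - s^{n,k}) (s^{n,k} - S(Q_{j''}))`. -/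
def Exchangeable {k : ℕ} (n : ℕ) (Q : Fin k → Finset ℕ) (j' j'' : Fin k) (z' z'' : ℕ) : Prop :=
  z' ∈ Q j' ∧ z'' ∈ Q j'' ∧ 0 < (z' : ℝ) - (z'' : ℝ) ∧
    (z' : ℝ) - (z'' : ℝ) ≤
      min (setSum (Q j') - targetSum n k) (targetSum n k - setSum (Q j''))

/-- One step of the randomized rounding algorithm after the random choices. The choices that the
algorithm leaves open (of parts, of elements, between ties) are nondeterministic. -/
inductive Step {k : ℕ} (α : Fin k → ℚ) (n : ℕ) : Config k → Config k → Prop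
  | move (Q : Fin k → Finset ℕ) (j' j'' : Fin k) (z : ℕ)
      (hj : SizePair α n Q j' j'') (hz : z ∈ Q j') :
      Step α n (.sizing Q)
        (.sizing (Function.update (Function.update Q j' (Q j' \ {z})) j'' (Q j'' ∪ {z})))
  | sized (Q : Fin k → Finset ℕ) (h : ¬ ∃ j' j'', SizePair α n Q j' j'') :
      Step α n (.sizing Q) (.balancing Q)
  | exchange (Q : Fin k → Finset ℕ) (j' j'' : Fin k) (z' z'' : ℕ)
      (h : ∃ j, setSum (Q j) ≠ targetSum n k) (hj : SumPair Q j' j'')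
      (hz : Exchangeable n Q j' j'' z' z'')
      (hmax : ∀ w' w'', Exchangeable n Q j' j'' w' w'' →
        (w' : ℝ) - (w'' : ℝ) ≤ (z' : ℝ) - (z'' : ℝ)) :
      Step α n (.balancing Q)
        (.balancing (Function.update (Function.update Q j' ((Q j' \ {z'}) ∪ {z''})) j''
          ((Q j'' \ {z''}) ∪ {z'})))
  | fail (Q : Fin k → Finset ℕ) (j' j'' : Fin k)
      (h : ∃ j, setSum (Q j) ≠ targetSum n k) (hj : SumPair Q j' j'')
      (hz : ¬ ∃ z' z'', Exchangeable n Q j' j'' z' z'') :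
      Step α n (.balancing Q) .failure
  | finish (Q : Fin k → Finset ℕ) (h : ∀ j, setSum (Q j) = targetSum n k) :
      Step α n (.balancing Q) (.returned Q)

/-- `Q_1, …, Q_k` is a partition of `[n]` with `|Q_j| = α_j n` and equal sums. -/
structure IsEqualSumPartition {k : ℕ} (α : Fin k → ℚ) (n : ℕ) (Q : Fin k → Finset ℕ) : Prop where
  disjoint : ∀ j j', j ≠ j' → Disjoint (Q j) (Q j')
  union : Finset.univ.biUnion Q = Finset.Icc 1 n
  card : ∀ j, ((Q j).card : ℝ) = (α j : ℝ) * (n : ℝ)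
  sum : ∀ j, setSum (Q j) = targetSum n k

/-- Every run from the given configuration, whatever choices are made, is finite and ends by
returning an equal-sum partition with the prescribed part sizes. -/
inductive Succeeds {k : ℕ} (α : Fin k → ℚ) (n : ℕ) : Config k → Prop
  | returned (Q : Fin k → Finset ℕ) (h : IsEqualSumPartition α n Q) :
      Succeeds α n (.returned Q)
  | step (c : Config k) (hex : ∃ c', Step α n c c')
      (hall : ∀ c', Step α n c c' → Succeeds α n c') : Succeeds α n c

/-- The random choices `X` for which some run of the algorithm does not solve the problem. -/
def failureEvent {k : ℕ} (α : Fin k → ℚ) (n : ℕ) : Set (Fin n → Fin k) :=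
  {X | ¬ Succeeds α n (.sizing (initialSets X))}

end EqualSumPartition

/-! The matrix returned by the recursion solves the fluid problem exactly, so under the random
choices each part has expected size `α j * n` and expected sum s. By Hoeffding's inequality all
sizes are off by at most ε n and all sums by at most ε n², outside an event of exponentially small
probability. It remains to see that the two loops repair such deviations while moving fewer than g n
elements, and that so few moves cannot exhaust the exchanges needed by the second loop.

The supply of exchanges comes from a lower bound on the matrix: elements z ≤ ρ n go to every part
with probability at least a constant c (`IsLinearFamily.exists_positiveSolution`). Hence for every d
up to about ρ n / 2 and every two parts, typically a linear number of disjoint pairs z, z + d is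
split between these parts in the wanted order.

The bound c rests on the slack, through the invariant `Feasible` of the recursion. It keeps the
first target lighter than the same volume of the first source, with a margin D of order n², which
also keeps the volume of this target of order n. While two targets remain, the first source is
denser than ρ; so the light sources stay intact until a single target is left, and undoing the
merges divides them in proportions bounded away from 0. The same invariant shows that every pour
either empties a source or makes two densities equal, which gives termination.

The loops are then analysed deterministically (`Succeeds.sizing`, `Succeeds.balancing`). Each move
of the first loop repairs the sizes and disturbs the sums by O(n). Each exchange of maximal
difference lowers the total sum deviation E by H, of order n, or by a share 1/k of itself. So about
E/H + 2k√E exchanges suffice, a small multiple of n if E is a small multiple of n². Fewer elements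
are touched than there are disjoint pairs, so a suitable pair always survives. A union bound over
O(n) atypical events finishes the proof. -/

namespace EqualSumPartition

/-! ### Correctness of the fluid mixing algorithm -/

/-- `f j + f (j + 1) + ⋯`. -/
noncomputable def tailSum {l : ℕ} (f : Fin l → ℝ) (j : Fin l) : ℝ :=
  ∑ i, if j ≤ i then f i else 0

lemma tailSum_zero {l : ℕ} (f : Fin (l + 1) → ℝ) : tailSum f 0 = ∑ i, f i := by
  simp [tailSum]

lemma tailSum_succ {l : ℕ} (f : Fin (l + 1) → ℝ) (j : Fin l) :
    tailSum f j.succ = tailSum (Fin.tail f) j := by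
  simp [tailSum, Fin.sum_univ_succ, Fin.tail]

/-- The fluid mixing problems met by the recursion when it is started on a partition problem with
positive slack: the sources have densities `m + 1, m, …, 1` and volumes `t, 1, …, 1`, the targets
have non-ascending densities, and the lightest fluid that fills the targets from the `j`-th on
is lighter by at least `D` than the mass prescribed for these targets. -/
structure Feasible (n : ℕ) (D ρ : ℝ) {m l : ℕ} (π : FluidProblem (m + 1) (l + 1)) (t : ℝ) :
    Prop where
  t_nonneg : 0 ≤ t
  t_le : t ≤ 1
  le_n : m + 1 ≤ n
  u_eq : π.u = Fin.cons t fun _ => 1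
  a_eq : π.a = Fin.cons (t * (m + 1)) fun i => (m : ℝ) - i.val
  v_zero : 0 < π.v 0
  v_succ : ∀ j : Fin l, ρ ≤ π.v j.succ
  b_nonneg : ∀ j, 0 ≤ π.b j
  sorted : ∀ i j : Fin l, i ≤ j → π.b j.succ * π.v i.succ ≤ π.b i.succ * π.v j.succ
  sorted_zero : ∀ j : Fin l, π.b j.succ * π.v 0 ≤ π.b 0 * π.v j.succ
  -- The mass of the lightest fluid of volume V is convex and piecewise linear in V with slopes 1,
  -- 2, …; it is the maximum over q of its tangents q V - q (q - 1) / 2. The first target is left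
  -- out, so pouring does not affect the condition; q runs up to n, so deleting sources does not
  -- either.
  tail : ∀ (j : Fin l) (q : ℕ), q ≤ n →
    q * tailSum (Fin.tail π.v) j - q * (q - 1) / 2 + D ≤ tailSum (Fin.tail π.b) j
  v_sum : ∑ j, π.v j = m + t
  b_sum : ∑ j, π.b j = (m + 1) * t + m * (m + 1) / 2

/-- `x` solves the fluid mixing problem `π`, and its entries for the source containers of density
at most `ρ` are at least `c`. The first source container has density `m`. -/
structure IsPositiveSolution {m l : ℕ} (π : FluidProblem m l) (ρ c : ℝ)
    (x : Fin m → Fin l → ℝ) : Prop where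
  nonneg : ∀ i j, 0 ≤ x i j
  row : ∀ i, ∑ j, x i j = 1
  volume : ∀ j, ∑ i, x i j * π.u i = π.v j
  mass : ∀ j, ∑ i, x i j * π.a i = π.b j
  lower : ∀ i j, (m : ℝ) - i.val ≤ ρ → c ≤ x i j

variable {n : ℕ} {D ρ c : ℝ} {m l : ℕ} {t : ℝ}

/-- Take the tangent q = m + 1, the density of the first source, in `tail` and subtract from the
totals. This inequality makes the denominator in the pouring fraction positive. -/
lemma Feasible.mass_zero_le {π : FluidProblem (m + 1) (l + 2)} (h : Feasible n D ρ π t) :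
    π.b 0 + D ≤ (m + 1) * π.v 0 := by
  have h1 := h.tail 0 (m + 1) h.le_n
  rw [tailSum_zero, tailSum_zero] at h1
  have hv := h.v_sum
  have hb := h.b_sum
  rw [Fin.sum_univ_succ] at hv hb
  simp only [Fin.tail] at h1
  push_cast at h1
  have e1 : ∑ i : Fin (l + 1), π.v i.succ = m + t - π.v 0 := by linarith
  rw [e1] at h1
  nlinarith

lemma Feasible.v_zero_ge {π : FluidProblem (m + 1) (l + 2)} (h : Feasible n D ρ π t) :
    D ≤ n * π.v 0 := by
  have h1 := h.mass_zero_le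
  have h2 := h.b_nonneg 0
  have h3 : ((m : ℝ) + 1) ≤ n := by exact_mod_cast h.le_n
  nlinarith [h.v_zero]

/-- Together with v 0 > 0 and v 1 ≥ ρ this gives ρ < m + 1: while two targets remain, the first
source is too dense to be concerned by `IsPositiveSolution.lower`. -/
lemma Feasible.sum_v_le (hρ : 0 < ρ) {π : FluidProblem (m + 1) (l + 2)}
    (h : Feasible n D ρ π t) : π.v 0 + π.v 1 ≤ m + t := by
  have hv := h.v_sum
  rw [Fin.sum_univ_succ, Fin.sum_univ_succ] at hv
  have : 0 ≤ ∑ i : Fin l, π.v i.succ.succ :=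
    Finset.sum_nonneg fun i _ => hρ.le.trans (h.v_succ i.succ)
  simp only [Fin.succ_zero_eq_one] at hv
  linarith

lemma Feasible.delete {π : FluidProblem (m + 2) (l + 1)} (h : Feasible n D ρ π 0) :
    Feasible n D ρ (m := m) { a := Fin.tail π.a, u := Fin.tail π.u, b := π.b, v := π.v } 1 where
  t_nonneg := zero_le_one
  t_le := le_rfl
  le_n := by have := h.le_n; omega
  u_eq := by
    rw [h.u_eq, Fin.tail_cons]
    ext i
    refine Fin.cases ?_ (fun i => ?_) i <;> simp
  a_eq := by
    rw [h.a_eq, Fin.tail_cons]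
    ext i
    refine Fin.cases ?_ (fun i => ?_) i <;> simp
  v_zero := h.v_zero
  v_succ := h.v_succ
  b_nonneg := h.b_nonneg
  sorted := h.sorted
  sorted_zero := h.sorted_zero
  tail := h.tail
  v_sum := by have := h.v_sum; push_cast at this; simp only; linarith
  b_sum := by have := h.b_sum; push_cast at this; simp only; linarith

lemma IsPositiveSolution.delete {π : FluidProblem (m + 2) (l + 2)} (hρ : 0 < ρ)
    (h : Feasible n D ρ π 0) {x : Fin (m + 1) → Fin (l + 2) → ℝ}
    (hx : IsPositiveSolution
      { a := Fin.tail π.a, u := Fin.tail π.u, b := π.b, v := π.v } ρ c x) :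
    IsPositiveSolution π ρ c (Fin.cons (Pi.single 0 1) x) := by
  have hu : π.u 0 = 0 := by rw [h.u_eq]; simp
  have ha : π.a 0 = 0 := by rw [h.a_eq]; simp
  refine ⟨fun i => ?_, fun i => ?_, fun j => ?_, fun j => ?_, fun i => ?_⟩
  · refine Fin.cases (fun j => ?_) (fun i j => ?_) i
    · simp only [Fin.cons_zero, Pi.single_apply]; split_ifs <;> norm_num
    · simpa using hx.nonneg i j
  · refine Fin.cases ?_ (fun i => ?_) i
    · simp
    · simpa using hx.row i
  · rw [Fin.sum_univ_succ, hu]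
    simpa [Fin.tail] using hx.volume j
  · rw [Fin.sum_univ_succ, ha]
    simpa [Fin.tail] using hx.mass j
  · refine Fin.cases (fun j hi => ?_) (fun i j hi => ?_) i
    · have h1 := h.sum_v_le hρ
      have h2 := h.v_succ 0
      have h3 := h.v_zero
      simp only [Fin.succ_zero_eq_one] at h2
      push_cast at hi h1
      simp only [Fin.val_zero] at hi
      norm_num at hi
      linarith
    · simp only [Fin.cons_succ]
      refine hx.lower i j ?_
      push_cast at hi ⊢
      simp only [Fin.val_succ] at hi
      push_cast at hi
      linarith

lemma Feasible.merge (hρ : 0 < ρ) {π : FluidProblem (m + 1) (l + 2)} (h : Feasible n D ρ π t) :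
    Feasible n D ρ (l := l)
      { a := π.a
        u := π.u
        b := Fin.cons (π.b 0 + π.b 1) (Fin.tail (Fin.tail π.b))
        v := Fin.cons (π.v 0 + π.v 1) (Fin.tail (Fin.tail π.v)) } t where
  t_nonneg := h.t_nonneg
  t_le := h.t_le
  le_n := h.le_n
  u_eq := h.u_eq
  a_eq := h.a_eq
  v_zero := by
    have := h.v_succ 0
    have := h.v_zero
    simp only [Fin.succ_zero_eq_one, Fin.cons_zero] at *
    linarith
  v_succ j := by simpa [Fin.tail] using h.v_succ j.succ
  b_nonneg j := by
    refine Fin.cases ?_ (fun j => ?_) j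
    · simpa using add_nonneg (h.b_nonneg 0) (h.b_nonneg 1)
    · simpa [Fin.tail] using h.b_nonneg j.succ.succ
  sorted i j hij := by
    simpa [Fin.tail] using h.sorted i.succ j.succ (Fin.succ_le_succ_iff.mpr hij)
  sorted_zero j := by
    have h1 := h.sorted_zero j.succ
    have h2 := h.sorted 0 j.succ (Fin.zero_le _)
    simp only [Fin.succ_zero_eq_one] at h2
    simp only [Fin.cons_zero, Fin.cons_succ, Fin.tail]
    linarith
  tail j q hq := by
    have := h.tail j.succ q hq
    rw [tailSum_succ, tailSum_succ] at this
    simpa using this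
  v_sum := by
    rw [← h.v_sum, Fin.sum_univ_succ, Fin.sum_univ_succ, Fin.sum_univ_succ (n := l)]
    simp [Fin.tail, add_assoc]
  b_sum := by
    rw [← h.b_sum, Fin.sum_univ_succ, Fin.sum_univ_succ, Fin.sum_univ_succ (n := l)]
    simp [Fin.tail, add_assoc]

/-- Since the densities agree, dividing by volume also divides the mass correctly. Both shares are
at least c': here v 0 ≥ D / n ≥ c' n and v 1 ≥ ρ ≥ c' n, while v 0 + v 1 ≤ n. -/
lemma IsPositiveSolution.merge (hρ : 0 < ρ) {π : FluidProblem (m + 1) (l + 2)}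
    (h : Feasible n D ρ π t) (hd : π.b 0 * π.v 1 = π.b 1 * π.v 0)
    {c' : ℝ} (hc' : 0 ≤ c') (hc1' : c' ≤ 1) (hc : 0 ≤ c) (h0 : c' * n ^ 2 ≤ D) (h1 : c' * n ≤ ρ)
    {x : Fin (m + 1) → Fin (l + 1) → ℝ}
    (hx : IsPositiveSolution
      { a := π.a
        u := π.u
        b := Fin.cons (π.b 0 + π.b 1) (Fin.tail (Fin.tail π.b))
        v := Fin.cons (π.v 0 + π.v 1) (Fin.tail (Fin.tail π.v)) } ρ c x) :
    IsPositiveSolution π ρ (c * c') fun i =>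
      Fin.cons (π.v 0 / (π.v 0 + π.v 1) * x i 0)
        (Fin.cons ((1 - π.v 0 / (π.v 0 + π.v 1)) * x i 0) (Fin.tail (x i))) := by
  have hv0 := h.v_zero
  have hv1 := h.v_succ 0
  simp only [Fin.succ_zero_eq_one] at hv1
  have hv1' : 0 < π.v 1 := hρ.trans_le hv1
  have hvs : 0 < π.v 0 + π.v 1 := by linarith
  have hnpos : 0 < (n : ℝ) := by have := h.le_n; exact_mod_cast (by omega : 0 < n)
  have hsn : π.v 0 + π.v 1 ≤ n := by
    have h2 := h.sum_v_le hρ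
    have h3 : ((m : ℝ) + 1) ≤ n := by exact_mod_cast h.le_n
    linarith [h.t_le]
  set γ := π.v 0 / (π.v 0 + π.v 1) with hγ
  have hγv : γ * (π.v 0 + π.v 1) = π.v 0 := by rw [hγ]; field_simp
  have hγb : γ * (π.b 0 + π.b 1) = π.b 0 := by rw [hγ]; field_simp; linarith
  have hγ0 : c' ≤ γ := by
    rw [hγ, le_div_iff₀ hvs]
    have h4 := h.v_zero_ge
    have h5 : c' * n ≤ π.v 0 := by
      by_contra hlt
      push Not at hlt
      nlinarith
    nlinarith
  have hγ1 : c' ≤ 1 - γ := by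
    have : 1 - γ = π.v 1 / (π.v 0 + π.v 1) := by rw [hγ]; field_simp; ring
    rw [this, le_div_iff₀ hvs]
    nlinarith
  refine ⟨fun i j => ?_, fun i => ?_, fun j => ?_, fun j => ?_, fun i j hi => ?_⟩
  · refine Fin.cases ?_ (fun j => Fin.cases ?_ (fun j => ?_) j) j
    · simpa using mul_nonneg (hc'.trans hγ0) (hx.nonneg i 0)
    · simpa using mul_nonneg (hc'.trans hγ1) (hx.nonneg i 0)
    · simpa [Fin.tail] using hx.nonneg i j.succ
  · have := hx.row i
    rw [Fin.sum_univ_succ] at this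
    rw [Fin.sum_univ_succ, Fin.sum_univ_succ]
    simp only [Fin.cons_zero, Fin.cons_succ, Fin.tail]
    linarith
  · have hx0 := hx.volume 0
    simp only [Fin.cons_zero] at hx0
    refine Fin.cases ?_ (fun j => Fin.cases ?_ (fun j => ?_) j) j
    · simp only [Fin.cons_zero, mul_assoc, ← Finset.mul_sum, hx0, hγv]
    · have e : ∀ i, (Fin.cons (γ * x i 0) (Fin.cons ((1 - γ) * x i 0) (Fin.tail (x i))) :
          Fin (l + 2) → ℝ) 1 = (1 - γ) * x i 0 := fun i => rfl
      simp only [e, mul_assoc, ← Finset.mul_sum, hx0, Fin.succ_zero_eq_one]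
      linarith
    · simpa [Fin.tail] using hx.volume j.succ
  · have hx0 := hx.mass 0
    simp only [Fin.cons_zero] at hx0
    refine Fin.cases ?_ (fun j => Fin.cases ?_ (fun j => ?_) j) j
    · simp only [Fin.cons_zero, mul_assoc, ← Finset.mul_sum, hx0, hγb]
    · have e : ∀ i, (Fin.cons (γ * x i 0) (Fin.cons ((1 - γ) * x i 0) (Fin.tail (x i))) :
          Fin (l + 2) → ℝ) 1 = (1 - γ) * x i 0 := fun i => rfl
      simp only [e, mul_assoc, ← Finset.mul_sum, hx0, Fin.succ_zero_eq_one]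
      linarith
    · simpa [Fin.tail] using hx.mass j.succ
  · have hl := hx.lower i
    refine Fin.cases ?_ (fun j => Fin.cases ?_ (fun j => ?_) j) j
    · simp only [Fin.cons_zero]
      rw [mul_comm]
      exact mul_le_mul hγ0 (hl 0 hi) hc (hc'.trans hγ0)
    · simp only [Fin.cons_zero, Fin.cons_succ]
      rw [mul_comm]
      exact mul_le_mul hγ1 (hl 0 hi) hc (hc'.trans hγ1)
    · simp only [Fin.cons_succ, Fin.tail]
      exact (mul_le_of_le_one_right hc hc1').trans (hl j.succ hi)

/-- The problem left after the fraction `lam` of the first source container has been poured into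
the first target container. -/
noncomputable def pourFirst (π : FluidProblem (m + 1) (l + 2)) (lam : ℝ) :
    FluidProblem (m + 1) (l + 2) where
  a := Function.update π.a 0 (π.a 0 - lam * π.a 0)
  u := Function.update π.u 0 (π.u 0 - lam * π.u 0)
  b := Function.update π.b 0 (π.b 0 - lam * π.a 0)
  v := Function.update π.v 0 (π.v 0 - lam * π.u 0)

/-- The fraction that the algorithm pours. -/
noncomputable def pourFraction (π : FluidProblem (m + 1) (l + 2)) : ℝ :=
  min 1 (min (π.v 0 / π.u 0)
        ((π.b 0 * π.v 1 - π.v 0 * π.b 1) / (π.a 0 * π.v 1 - π.u 0 * π.b 1)))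

/-- The term v 0 / u 0 never decides the minimum: otherwise the first target would be at least as
dense as the first source, against `Feasible.mass_zero_le`. So a pour either empties the source or
stops exactly when the first two targets have equal density, and the order of densities is kept. -/
lemma Feasible.pourFraction_spec (hρ : 0 < ρ) (hD : 0 < D) {π : FluidProblem (m + 1) (l + 2)}
    (h : Feasible n D ρ π t) (ht : t ≠ 0) (hd : π.b 0 * π.v 1 ≠ π.b 1 * π.v 0) :
    0 ≤ pourFraction π ∧ pourFraction π ≤ 1 ∧ 0 < π.v 0 - pourFraction π * t ∧
    π.b 1 * (π.v 0 - pourFraction π * t) ≤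
      (π.b 0 - pourFraction π * (t * (m + 1))) * π.v 1 ∧
    (pourFraction π ≠ 1 → (π.b 0 - pourFraction π * (t * (m + 1))) * π.v 1 =
      π.b 1 * (π.v 0 - pourFraction π * t)) := by
  have ht' : 0 < t := lt_of_le_of_ne h.t_nonneg ht.symm
  have hu : π.u 0 = t := by rw [h.u_eq]; simp
  have ha : π.a 0 = t * (m + 1) := by rw [h.a_eq]; simp
  have hv0 := h.v_zero
  have hv1 := h.v_succ 0
  have hs := h.sorted_zero 0
  simp only [Fin.succ_zero_eq_one] at hv1 hs
  have hv1' : 0 < π.v 1 := hρ.trans_le hv1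
  have hm := h.mass_zero_le
  have hs' : 0 < π.b 0 * π.v 1 - π.v 0 * π.b 1 := by
    rcases hs.lt_or_eq with h1 | h1
    · linarith
    · exact absurd h1.symm hd
  have hden : 0 < (m + 1) * π.v 1 - π.b 1 := by
    have : 0 < π.v 0 * ((m + 1) * π.v 1 - π.b 1) := by nlinarith
    exact pos_of_mul_pos_right this hv0.le
  have hA : π.a 0 * π.v 1 - π.u 0 * π.b 1 = t * ((m + 1) * π.v 1 - π.b 1) := by
    rw [ha, hu]; ring
  set q := (π.b 0 * π.v 1 - π.v 0 * π.b 1) / (t * ((m + 1) * π.v 1 - π.b 1)) with hq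
  have hq0 : 0 < q := by positivity
  have hqmul : q * t * ((m + 1) * π.v 1 - π.b 1) = π.b 0 * π.v 1 - π.v 0 * π.b 1 := by
    rw [hq, mul_assoc, div_mul_cancel₀ _ (by positivity)]
  have hqt : q * t < π.v 0 := by
    by_contra hcon
    push Not at hcon
    nlinarith [mul_le_mul_of_nonneg_right hcon hden.le]
  have hpf : pourFraction π = min 1 q := by
    rw [pourFraction, hA, ← hq, hu, min_eq_right (a := π.v 0 / t)]
    rw [le_div_iff₀ ht']; exact hqt.le
  rw [hpf]
  have hmin : min 1 q * t ≤ q * t := mul_le_mul_of_nonneg_right (min_le_right _ _) ht'.le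
  refine ⟨le_min zero_le_one hq0.le, min_le_left _ _, by linarith, ?_, fun hne => ?_⟩
  · have := mul_le_mul_of_nonneg_right hmin hden.le
    nlinarith
  · rcases min_choice 1 q with h1 | h1
    · exact absurd h1 hne
    · rw [h1]; linarith

lemma Feasible.pour (hρ : 0 < ρ) {π : FluidProblem (m + 1) (l + 2)} (h : Feasible n D ρ π t)
    {lam : ℝ} (h0 : 0 ≤ lam) (h1 : lam ≤ 1) (hv : 0 < π.v 0 - lam * t)
    (hd : π.b 1 * (π.v 0 - lam * t) ≤ (π.b 0 - lam * (t * (m + 1))) * π.v 1) :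
    Feasible n D ρ (pourFirst π lam) (t - lam * t) := by
  have hu : π.u 0 = t := by rw [h.u_eq]; simp
  have ha : π.a 0 = t * (m + 1) := by rw [h.a_eq]; simp
  have hv1 := h.v_succ 0
  simp only [Fin.succ_zero_eq_one] at hv1
  have hv1' : 0 < π.v 1 := hρ.trans_le hv1
  have ht := h.t_nonneg
  have hb0 : 0 ≤ π.b 0 - lam * (t * (m + 1)) := by
    have : 0 ≤ (π.b 0 - lam * (t * (m + 1))) * π.v 1 :=
      (mul_nonneg (h.b_nonneg 1) hv.le).trans hd
    exact nonneg_of_mul_nonneg_left this hv1'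
  refine ⟨by nlinarith, by nlinarith [h.t_le], h.le_n, ?_, ?_, ?_, fun j => ?_, fun j => ?_,
    fun i j hij => ?_, fun j => ?_, fun j q hq => ?_, ?_, ?_⟩
  · simp only [pourFirst, h.u_eq]
    ext i
    refine Fin.cases ?_ (fun i => ?_) i <;> simp
  · simp only [pourFirst, h.a_eq]
    ext i
    refine Fin.cases ?_ (fun i => ?_) i
    · simp; ring
    · simp
  · simpa [pourFirst, hu] using hv
  · simpa [pourFirst] using h.v_succ j
  · refine Fin.cases ?_ (fun j => ?_) j
    · simpa [pourFirst, ha] using hb0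
    · simpa [pourFirst] using h.b_nonneg j.succ
  · simpa [pourFirst] using h.sorted i j hij
  · have h2 := h.sorted 0 j (Fin.zero_le _)
    simp only [Fin.succ_zero_eq_one] at h2
    have hvj := hρ.le.trans (h.v_succ j)
    suffices π.b j.succ * (π.v 0 - lam * t) ≤ (π.b 0 - lam * (t * (m + 1))) * π.v j.succ by
      simpa [pourFirst, ha, hu] using this
    -- Transitivity of the density order through target 1, with denominators cleared by v 1.
    refine le_of_mul_le_mul_right ?_ hv1'
    nlinarith [mul_le_mul_of_nonneg_right h2 hv.le, mul_le_mul_of_nonneg_right hd hvj]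
  · simpa [pourFirst, Fin.tail_update_zero] using h.tail j q hq
  · have := h.v_sum
    rw [Fin.sum_univ_succ] at this ⊢
    simp [pourFirst, hu] at this ⊢
    linarith
  · have := h.b_sum
    rw [Fin.sum_univ_succ] at this ⊢
    simp [pourFirst, ha] at this ⊢
    linarith

lemma IsPositiveSolution.pour (hρ : 0 < ρ) {π : FluidProblem (m + 1) (l + 2)}
    (h : Feasible n D ρ π t) {lam : ℝ} (h0 : 0 ≤ lam) (h1 : lam ≤ 1)
    {x : Fin (m + 1) → Fin (l + 2) → ℝ} (hx : IsPositiveSolution (pourFirst π lam) ρ c x) :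
    IsPositiveSolution π ρ c (Function.update x 0
        (fun j => lam * (Pi.single 0 1 : Fin (l + 2) → ℝ) j + (1 - lam) * x 0 j)) := by
  have hs : ∀ j, 0 ≤ (Pi.single 0 1 : Fin (l + 2) → ℝ) j := fun j => by
    rw [Pi.single_apply]; split_ifs <;> norm_num
  refine ⟨fun i => ?_, fun i => ?_, fun j => ?_, fun j => ?_, fun i => ?_⟩
  · refine Fin.cases (fun j => ?_) (fun i j => ?_) i
    · simp only [Function.update_self]
      exact add_nonneg (mul_nonneg h0 (hs j)) (mul_nonneg (by linarith) (hx.nonneg 0 j))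
    · simpa using hx.nonneg i.succ j
  · refine Fin.cases ?_ (fun i => ?_) i
    · simp only [Function.update_self]
      rw [Finset.sum_add_distrib, ← Finset.mul_sum, ← Finset.mul_sum, hx.row]
      simp
    · simpa using hx.row i.succ
  · have := hx.volume j
    rw [Fin.sum_univ_succ] at this ⊢
    simp only [pourFirst, Function.update_self, ne_eq, Fin.succ_ne_zero,
      not_false_eq_true, Function.update_of_ne] at this ⊢
    revert this
    refine Fin.cases (fun this => ?_) (fun j this => ?_) j
    · simp at this ⊢; linarith
    · simp at this ⊢; linarith
  · have := hx.mass j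
    rw [Fin.sum_univ_succ] at this ⊢
    simp only [pourFirst, Function.update_self, ne_eq, Fin.succ_ne_zero,
      not_false_eq_true, Function.update_of_ne] at this ⊢
    revert this
    refine Fin.cases (fun this => ?_) (fun j this => ?_) j
    · simp at this ⊢; linarith
    · simp at this ⊢; linarith
  · refine Fin.cases (fun j hi => ?_) (fun i j hi => ?_) i
    · have h1 := h.sum_v_le hρ
      have h2 := h.v_succ 0
      have h3 := h.v_zero
      have h4 := h.t_le
      simp only [Fin.succ_zero_eq_one] at h2
      push_cast at hi h1
      simp only [Fin.val_zero] at hi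
      norm_num at hi
      linarith
    · simpa using hx.lower i.succ j hi

-- The quantity bounded by N falls at every call. A deletion lowers m but makes t nonzero; a merge
-- lowers l but may make the first densities differ; a pour starts with both indicators equal to 1
-- and turns one of them to 0. Each merge costs a factor c, hence the bound c ^ l. The index 1 is
-- written with `Fin.ofNat` because l = 0 is included.
open Classical in
theorem Feasible.exists_returns (hρ : 0 < ρ) (hD : 0 < D) (hc : 0 ≤ c) (hc1 : c ≤ 1)
    (hcD : c * n ^ 2 ≤ D) (hcρ : c * n ≤ ρ) (N : ℕ) :
    ∀ {m l : ℕ} {t : ℝ} (π : FluidProblem (m + 1) (l + 1)), Feasible n D ρ π t →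
      (∀ l', l = l' + 1 → 2 * l + 2 * m + (if t = 0 then 0 else 1) +
        (if π.b 0 * π.v (Fin.ofNat _ 1) = π.b (Fin.ofNat _ 1) * π.v 0 then 0 else 1) < N) →
      (l = 0 → 0 < N) →
      ∃ x, FluidMixingReturns π x ∧ IsPositiveSolution π ρ (c ^ l) x := by
  induction N with
  | zero =>
    intro m l t π h h1 h2
    rcases l with _ | l
    · exact absurd (h2 rfl) (lt_irrefl _)
    · exact absurd (h1 l rfl) (by omega)
  | succ N ih =>
    intro m l t π h hN _
    rcases l with _ | l
    · refine ⟨fun _ _ => 1, ⟨1, by simp [fluidMixingSolve]⟩, ?_⟩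
      refine ⟨by simp, by simp, fun j => ?_, fun j => ?_, by simp⟩
      · have := h.v_sum
        fin_cases j
        simp [h.u_eq, Fin.sum_univ_succ] at this ⊢
        linarith
      · have := h.b_sum
        fin_cases j
        simp [h.a_eq, Fin.sum_univ_succ] at this ⊢
        have e : ∀ k : ℕ, ∑ i : Fin k, (i.val : ℝ) = k * (k - 1) / 2 := by
          intro k
          rw [Fin.sum_univ_eq_sum_range (fun i => (i : ℝ)) k]
          induction k with
          | zero => simp
          | succ k ihk => rw [Finset.sum_range_succ, ihk]; push_cast; ring
        rw [e, this]; ring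
    specialize hN l rfl
    have h1' : Fin.ofNat (l + 1 + 1) 1 = 1 := rfl
    rw [h1'] at hN
    have hu : π.u 0 = t := by rw [h.u_eq]; simp
    have hv0 := h.v_zero
    have hv1 : 0 < π.v 1 := by
      have := h.v_succ 0
      rw [Fin.succ_zero_eq_one] at this
      exact hρ.trans_le this
    by_cases ht : t = 0
    · subst ht
      rcases m with _ | m
      · have := h.sum_v_le hρ
        norm_num at this
        linarith
      obtain ⟨x, ⟨d, hd⟩, hx⟩ := ih _ h.delete (fun l' _ => by
        simp only [h1']
        simp only [if_true, one_ne_zero, if_false] at hN ⊢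
        omega) (by omega)
      refine ⟨_, ⟨d + 1, ?_⟩, hx.delete hρ h⟩
      rw [fluidMixingSolve, if_pos hu, hd]
      rfl
    by_cases hd : π.b 0 * π.v 1 = π.b 1 * π.v 0
    · obtain ⟨x, ⟨d, hs⟩, hx⟩ := ih _ (h.merge hρ) (fun l' _ => by
        rw [if_neg ht] at hN ⊢
        split_ifs <;> split_ifs at hN <;> omega) (by omega)
      refine ⟨_, ⟨d + 1, ?_⟩, hx.merge hρ h hd hc hc1 (pow_nonneg hc l) hcD hcρ⟩
      rw [fluidMixingSolve, if_neg (by rwa [hu]), if_neg hv0.ne',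
        if_pos (by rw [div_eq_div_iff hv0.ne' hv1.ne', hd]), hs]
      rfl
    · obtain ⟨p0, p1, p2, p3, p4⟩ := h.pourFraction_spec hρ hD ht hd
      obtain ⟨x, ⟨d, hs⟩, hx⟩ := ih _ (h.pour hρ p0 p1 p2 p3) (fun l' _ => by
        rw [if_neg ht, if_neg hd] at hN
        by_cases hp : pourFraction π = 1
        · have : t - pourFraction π * t = 0 := by rw [hp]; ring
          rw [if_pos this]
          split_ifs <;> omega
        · have ha : π.a 0 = t * (m + 1) := by rw [h.a_eq]; simp
          have := p4 hp
          rw [if_pos (c := _ = (pourFirst π (pourFraction π)).b _ * _)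
            (by rw [h1']; simpa [pourFirst, ha, hu] using this)]
          split_ifs <;> omega) (by omega)
      refine ⟨_, ⟨d + 1, ?_⟩, hx.pour hρ h p0 p1⟩
      rw [fluidMixingSolve, if_neg (by rwa [hu]), if_neg hv0.ne',
        if_neg (by rwa [div_eq_div_iff hv0.ne' hv1.ne'])]
      exact Option.bind_eq_some_iff.mpr ⟨x, hs, rfl⟩

end EqualSumPartition
namespace EqualSumPartition

/-! ### The fluid mixing problem of a partition problem -/

lemma tailSum_add_sum_lt {l : ℕ} (f : Fin l → ℝ) (j : Fin l) :
    tailSum f j + ∑ i : Fin l with i.val < j.val, f i = ∑ i, f i := by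
  rw [tailSum, Finset.sum_filter, ← Finset.sum_add_distrib]
  refine Finset.sum_congr rfl fun i _ => ?_
  by_cases h : j ≤ i
  · rw [if_pos h, if_neg (by simpa using h), add_zero]
  · rw [if_neg h, if_pos (by simpa using h), zero_add]

lemma IsLinearFamily.exists_slack {k : ℕ} {α : Fin k → ℚ} (hα : IsLinearFamily α) :
    ∃ σ : ℚ, 0 < σ ∧ ∀ j, 1 ≤ j → j < k → σ ≤ slackAt α j := by
  have hpos : ∀ j ∈ Finset.Ico 1 k, 0 < slackAt α j := fun j hj => by
    have := hα.slack_pos.trans_le (Finset.inf_le hj)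
    exact_mod_cast this
  by_cases hk : (Finset.Ico 1 k).Nonempty
  · obtain ⟨j, hj, hmin⟩ := Finset.exists_min_image _ (slackAt α) hk
    exact ⟨slackAt α j, hpos j hj, fun i h1 h2 => hmin i (Finset.mem_Ico.mpr ⟨h1, h2⟩)⟩
  · exact ⟨1, one_pos, fun j h1 h2 => absurd ⟨j, Finset.mem_Ico.mpr ⟨h1, h2⟩⟩ hk⟩

lemma IsLinearFamily.sum_real {k : ℕ} {α : Fin k → ℚ} (hα : IsLinearFamily α) :
    ∑ j, (α j : ℝ) = 1 := by
  exact_mod_cast hα.sum_eq_one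

lemma IsMember.exists_nat_sum {k : ℕ} {α : Fin k → ℚ} {n : ℕ} (h : IsMember α n)
    (s : Finset (Fin k)) : ∃ p : ℕ, ∑ j ∈ s, (α j : ℝ) * n = p := by
  choose p hp using h.integral
  refine ⟨∑ j ∈ s, p j, ?_⟩
  push_cast
  exact Finset.sum_congr rfl fun j _ => by exact_mod_cast hp j

/-- The lightest w elements of [n] sum to w (w + 1) / 2. The slack puts the prescribed tail sum
above this by σ n², up to a lower-order error of at most n / 2; half of the slack pays for the error
once σ n ≥ 1. -/
lemma partitionProblem_feasible {l m : ℕ} {α : Fin (l + 1) → ℚ} (hα : IsLinearFamily α)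
    {σ : ℚ} (hσ : ∀ j, 1 ≤ j → j < l + 1 → σ ≤ slackAt α j)
    (hm : IsMember α (m + 1)) (hn : 1 ≤ (σ : ℝ) * (m + 1 : ℕ)) :
    Feasible (m + 1) ((σ : ℝ) / 2 * (m + 1 : ℕ) ^ 2) ((α 0 : ℝ) * (m + 1 : ℕ))
      (partitionProblem α (m + 1)) 1 := by
  have hs : 0 ≤ targetSum (m + 1) (l + 1) := by unfold targetSum; positivity
  have hα0 : ∀ j, 0 ≤ (α j : ℝ) := fun j => by exact_mod_cast (hα.pos j).le
  have hn0 : (0 : ℝ) ≤ (m + 1 : ℕ) := by positivity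
  have hmono : ∀ i j, i ≤ j → (α i : ℝ) ≤ α j := fun i j h => by exact_mod_cast hα.mono h
  refine ⟨zero_le_one, le_rfl, le_rfl, ?_, ?_, ?_, fun j => ?_, fun j => hs,
    fun i j hij => ?_, fun j => ?_, fun j q hq => ?_, ?_, ?_⟩
  · ext i
    refine Fin.cases ?_ (fun i => ?_) i <;> simp [partitionProblem]
  · ext i
    refine Fin.cases ?_ (fun i => ?_) i <;> simp [partitionProblem]
  · have : (0 : ℝ) < α 0 := by exact_mod_cast hα.pos 0
    simp only [partitionProblem]
    positivity
  · exact mul_le_mul_of_nonneg_right (hmono _ _ (Fin.zero_le _)) hn0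
  · exact mul_le_mul_of_nonneg_left
      (mul_le_mul_of_nonneg_right (hmono _ _ (Fin.succ_le_succ_iff.mpr hij)) hn0) hs
  · exact mul_le_mul_of_nonneg_left
      (mul_le_mul_of_nonneg_right (hmono _ _ (Fin.zero_le _)) hn0) hs
  · rw [← tailSum_succ, ← tailSum_succ]
    set n := m + 1
    set A : ℝ := (partialSum α (j.val + 1) : ℝ) with hA
    have hA' : A = ∑ i : Fin (l + 1) with i.val < j.succ.val, (α i : ℝ) := by
      rw [hA, partialSum]; push_cast; rfl
    have hv := tailSum_add_sum_lt (partitionProblem α n).v j.succ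
    have hb := tailSum_add_sum_lt (partitionProblem α n).b j.succ
    have hvA : tailSum (partitionProblem α n).v j.succ = n * (1 - A) := by
      simp only [partitionProblem] at hv ⊢
      rw [← Finset.sum_mul, ← Finset.sum_mul, hα.sum_real, ← hA'] at hv
      linarith
    have hcard : (Finset.univ.filter fun i : Fin (l + 1) => i.val < j.succ.val).card =
        j.val + 1 := by
      rw [Fin.val_succ, Fin.card_filter_val_lt]
      omega
    have hbA : tailSum (partitionProblem α n).b j.succ =
        ((l + 1) - (j.val + 1)) * targetSum n (l + 1) := by
      simp only [partitionProblem, Finset.sum_const, hcard, Finset.card_univ,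
        Fintype.card_fin, nsmul_eq_mul] at hb ⊢
      push_cast at hb
      linarith
    obtain ⟨w, hw⟩ := hm.exists_nat_sum (Finset.univ.filter fun i => j.succ ≤ i)
    have hw' : tailSum (partitionProblem α n).v j.succ = w := by
      rw [tailSum, ← hw, Finset.sum_filter]; rfl
    -- Integrality of w enters here: a product of two consecutive integers is nonnegative.
    have hmain : (q : ℝ) * w - q * (q - 1) / 2 ≤ w * (w + 1) / 2 := by
      have : (0 : ℤ) ≤ ((w : ℤ) - q) * (w - q + 1) := by
        rcases le_or_gt 0 ((w : ℤ) - q) with h | h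
        · exact mul_nonneg h (by omega)
        · exact mul_nonneg_of_nonpos_of_nonpos h.le (by omega)
      have : (0 : ℝ) ≤ ((w : ℝ) - q) * (w - q + 1) := by exact_mod_cast this
      nlinarith
    have hsl : (σ : ℝ) ≤ A * (1 - A / 2) - (j.val + 1) / (2 * (l + 1)) := by
      have := hσ (j.val + 1) (by omega) (by omega)
      have := (Rat.cast_le (K := ℝ)).mpr this
      rw [slackAt] at this
      push_cast at this
      exact this
    have hA0 : 0 ≤ A := by rw [hA']; exact Finset.sum_nonneg fun i _ => hα0 i
    have hwA : (w : ℝ) = n * (1 - A) := by rw [← hw', hvA]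
    rw [hw', hbA]
    have hr1 : ((j.val : ℝ) + 1) / (l + 1) ≤ 1 := by
      rw [div_le_one (by positivity)]
      exact_mod_cast (by omega : j.val + 1 ≤ l + 1)
    set r := ((j.val : ℝ) + 1) / (l + 1) with hr
    have hr2 : ((j.val : ℝ) + 1) / (2 * (l + 1)) = r / 2 := by rw [hr]; field_simp
    have hB : ((l + 1) - (j.val + 1)) * targetSum n (l + 1) = (1 - r) * (n * (n + 1)) / 2 := by
      rw [hr, targetSum]; push_cast; field_simp
    rw [hB]
    rw [hr2] at hsl
    have h1 : (w : ℝ) * (w + 1) / 2 + (σ : ℝ) / 2 * n ^ 2 ≤ (1 - r) * (n * (n + 1)) / 2 := by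
      rw [hwA]
      have e1 := mul_le_mul_of_nonneg_right hsl (sq_nonneg (n : ℝ))
      have e2 := mul_le_mul_of_nonneg_right hn hn0
      have e3 := mul_nonneg hA0 hn0
      have e4 := mul_le_mul_of_nonneg_right hr1 hn0
      nlinarith
    linarith
  · simp only [partitionProblem]
    rw [← Finset.sum_mul, hα.sum_real]
    push_cast; ring
  · simp only [partitionProblem, Finset.sum_const, Finset.card_univ, Fintype.card_fin,
      nsmul_eq_mul, targetSum]
    push_cast
    field_simp
    ring

lemma IsLinearFamily.exists_positiveSolution {k : ℕ} {α : Fin k → ℚ} (hα : IsLinearFamily α) :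
    ∃ c ρ : ℝ, 0 < c ∧ 0 < ρ ∧ ρ ≤ 1 ∧ ∃ N : ℕ, ∀ n, N ≤ n → IsMember α n →
      ∃ x, FluidMixingReturns (partitionProblem α n) x ∧
        IsPositiveSolution (partitionProblem α n) (ρ * n) c x := by
  obtain ⟨σ, hσ, hslack⟩ := hα.exists_slack
  rcases k with _ | l
  · exact absurd hα.sum_eq_one (by simp)
  have hσ' : (0 : ℝ) < σ := by exact_mod_cast hσ
  have hα0 : (0 : ℝ) < α 0 := by exact_mod_cast hα.pos 0
  have hα1 : (α 0 : ℝ) ≤ 1 := by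
    rw [← hα.sum_real]
    exact Finset.single_le_sum (f := fun j => (α j : ℝ))
      (fun j _ => by exact_mod_cast (hα.pos j).le) (Finset.mem_univ 0)
  obtain ⟨N, hN⟩ := exists_nat_ge (1 / (σ : ℝ))
  -- Each of the l merges keeps a share of at least min (α 0) (σ / 2): the volumes are at least α 0
  -- n, and D = σ n² / 2.
  refine ⟨min (α 0 : ℝ) ((σ : ℝ) / 2) ^ l, α 0, by positivity, hα0, hα1, N, fun n hn hm => ?_⟩
  obtain ⟨m, rfl⟩ : ∃ m, n = m + 1 := ⟨n - 1, by have := hm.pos; omega⟩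
  have hn' : (0 : ℝ) < (m + 1 : ℕ) := by positivity
  refine (partitionProblem_feasible hα hslack hm ?_).exists_returns (by positivity)
    (by positivity) (by positivity) ((min_le_left _ _).trans hα1)
    (mul_le_mul_of_nonneg_right (min_le_right _ _) (by positivity))
    (mul_le_mul_of_nonneg_right (min_le_left _ _) hn'.le) (2 * l + 2 * m + 3) _
    (fun l' _ => ?_) (fun _ => by omega)
  · have : 1 / (σ : ℝ) ≤ (m + 1 : ℕ) := hN.trans (by exact_mod_cast hn)
    rwa [div_le_iff₀ hσ', mul_comm] at this
  · split_ifs <;> omega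

end EqualSumPartition
namespace EqualSumPartition

/-! ### Assignments of the elements of `[n]` to the parts -/

/-- The parts of the partition of `[n]` that puts `z` into the part `χ z`. -/
def parts (n : ℕ) {k : ℕ} (χ : ℕ → Fin k) (j : Fin k) : Finset ℕ :=
  (Finset.Icc 1 n).filter fun z => χ z = j

/-- The number of elements of `[n]` that `χ` and `χ'` put into different parts. -/
def changes (n : ℕ) {k : ℕ} (χ χ' : ℕ → Fin k) : ℕ :=
  ((Finset.Icc 1 n).filter fun z => χ' z ≠ χ z).card

/-- The total deviation of the sums of the parts from the target sum. -/
noncomputable def sumDeviation (n : ℕ) {k : ℕ} (χ : ℕ → Fin k) : ℝ :=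
  ∑ j, |setSum (parts n χ j) - targetSum n k|

/-- The total deviation of the sizes of the parts from the prescribed sizes. -/
noncomputable def sizeDeviation {k : ℕ} (α : Fin k → ℚ) (n : ℕ) (χ : ℕ → Fin k) : ℝ :=
  ∑ j, |((parts n χ j).card : ℝ) - (α j : ℝ) * n|

/-- For every `d ≤ h` and every two parts there are at least `G` disjoint pairs of elements, one
from each part, with difference `d`. -/
def HasManyPairs (n h : ℕ) (G : ℝ) {k : ℕ} (χ : ℕ → Fin k) : Prop :=
  ∀ (d : ℕ) (j' j'' : Fin k), 1 ≤ d → d ≤ h → j' ≠ j'' → ∃ Z : Finset ℕ, G ≤ (Z.card : ℝ) ∧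
    (∀ z ∈ Z, 1 ≤ z ∧ z + d ≤ n ∧ χ z = j'' ∧ χ (z + d) = j') ∧ ∀ z ∈ Z, ∀ w ∈ Z, z + d ≠ w

variable {n k : ℕ}

lemma mem_parts {χ : ℕ → Fin k} {j : Fin k} {z : ℕ} :
    z ∈ parts n χ j ↔ (1 ≤ z ∧ z ≤ n) ∧ χ z = j := by
  simp [parts]

lemma changes_self (χ : ℕ → Fin k) : changes n χ χ = 0 := by simp [changes]

lemma changes_update_le (χ₀ χ : ℕ → Fin k) (z : ℕ) (j : Fin k) :
    changes n χ₀ (Function.update χ z j) ≤ changes n χ₀ χ + 1 := by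
  refine (Finset.card_le_card (t := insert z _) fun w hw => ?_).trans (Finset.card_insert_le _ _)
  rw [Finset.mem_insert]
  by_cases hwz : w = z
  · exact Or.inl hwz
  · right
    simpa [Function.update_of_ne hwz] using hw

/-- The pairs are disjoint, so each altered element spoils at most one of them. -/
lemma HasManyPairs.exists_pair {h : ℕ} {G : ℝ} {χ₀ χ : ℕ → Fin k} (hp : HasManyPairs n h G χ₀)
    (hG : (changes n χ₀ χ : ℝ) < G) {d : ℕ} {j' j'' : Fin k} (h1 : 1 ≤ d) (h2 : d ≤ h)
    (hj : j' ≠ j'') : ∃ z, z + d ∈ parts n χ j' ∧ z ∈ parts n χ j'' := by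
  obtain ⟨Z, hZ, hmem, hdis⟩ := hp d j' j'' h1 h2 hj
  by_contra hcon
  push Not at hcon
  have hbad : ∀ z ∈ Z, χ z = χ₀ z → χ (z + d) ≠ χ₀ (z + d) := fun z hz e1 e2 => by
    obtain ⟨a1, a2, a3, a4⟩ := hmem z hz
    refine hcon z ?_ ?_
    · rw [mem_parts, e2]; exact ⟨⟨by omega, a2⟩, a4⟩
    · rw [mem_parts, e1]; exact ⟨⟨a1, by omega⟩, a3⟩
  have hle : Z.card ≤ changes n χ₀ χ := by
    refine Finset.card_le_card_of_injOn (fun z => if χ z = χ₀ z then z + d else z) ?_ ?_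
    · intro z hz
      obtain ⟨a1, a2, -, -⟩ := hmem z hz
      simp only [Finset.coe_filter, Set.mem_ofPred_eq, Finset.mem_Icc]
      split_ifs with e
      · exact ⟨by omega, hbad z hz e⟩
      · exact ⟨by omega, e⟩
    · intro z hz w hw hzw
      have d1 := hdis z hz w hw
      have d2 := hdis w hw z hz
      simp only at hzw
      split_ifs at hzw <;> omega
  have : (Z.card : ℝ) ≤ changes n χ₀ χ := by exact_mod_cast hle
  linarith

lemma parts_update {χ : ℕ → Fin k} {j' j'' : Fin k} (hj : j' ≠ j'') {z : ℕ}
    (hz : z ∈ parts n χ j') :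
    parts n (Function.update χ z j'') =
      Function.update (Function.update (parts n χ) j' (parts n χ j' \ {z})) j''
        (parts n χ j'' ∪ {z}) := by
  rw [mem_parts] at hz
  obtain ⟨hz1, hz2⟩ := hz
  funext j
  ext w
  by_cases h1 : j = j''
  · subst h1
    rw [Function.update_self, mem_parts, Finset.mem_union, mem_parts, Finset.mem_singleton]
    by_cases hw : w = z
    · subst hw; simpa using hz1
    · simp [hw]
  rw [Function.update_of_ne h1]
  by_cases h2 : j = j'
  · subst h2
    rw [Function.update_self, mem_parts, Finset.mem_sdiff, mem_parts, Finset.mem_singleton]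
    by_cases hw : w = z
    · subst hw; simpa using fun _ _ => hj.symm
    · simp [hw]
  · rw [Function.update_of_ne h2, mem_parts, mem_parts]
    by_cases hw : w = z
    · subst hw
      rw [Function.update_self, hz2]
      exact and_congr_right fun _ => ⟨fun e => absurd e.symm h1, fun e => absurd e.symm h2⟩
    · rw [Function.update_of_ne hw]

lemma parts_exchange {χ : ℕ → Fin k} {j' j'' : Fin k} (hj : j' ≠ j'') {z' z'' : ℕ}
    (hz' : z' ∈ parts n χ j') (hz'' : z'' ∈ parts n χ j'') :
    parts n (Function.update (Function.update χ z' j'') z'' j') =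
      Function.update (Function.update (parts n χ) j' ((parts n χ j' \ {z'}) ∪ {z''})) j''
        ((parts n χ j'' \ {z''}) ∪ {z'}) := by
  have hne : z' ≠ z'' := by
    rintro rfl
    rw [mem_parts] at hz' hz''
    exact hj (hz'.2.symm.trans hz''.2)
  have h'' : z'' ∈ parts n (Function.update χ z' j'') j'' := by
    rw [parts_update hj hz', Function.update_self]
    exact Finset.mem_union_left _ hz''
  rw [parts_update hj.symm h'', parts_update hj hz']
  funext j
  by_cases h1 : j = j'
  · subst h1
    simp [Function.update_of_ne hj]
  by_cases h2 : j = j''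
  · subst h2
    rw [Function.update_of_ne h1, Function.update_self, Function.update_self,
      Function.update_self, Finset.union_sdiff_distrib,
      Finset.sdiff_eq_self_of_disjoint (s := {z'}) (by simpa using hne)]
  · simp [Function.update_of_ne h1, Function.update_of_ne h2]

lemma card_move {Q : Finset ℕ} {z : ℕ} (hz : z ∈ Q) : ((Q \ {z}).card : ℝ) = Q.card - 1 := by
  rw [Finset.sdiff_singleton_eq_erase, Finset.card_erase_of_mem hz,
    Nat.cast_sub (Finset.card_pos.mpr ⟨z, hz⟩), Nat.cast_one]

lemma card_union_singleton {Q : Finset ℕ} {z : ℕ} (hz : z ∉ Q) :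
    ((Q ∪ {z}).card : ℝ) = Q.card + 1 := by
  rw [Finset.card_union_of_disjoint (by simpa using hz)]; simp

lemma setSum_sdiff {Q : Finset ℕ} {z : ℕ} (hz : z ∈ Q) : setSum (Q \ {z}) = setSum Q - z := by
  rw [setSum, setSum, ← Finset.sum_sdiff (Finset.singleton_subset_iff.mpr hz)]
  simp

lemma setSum_union {Q : Finset ℕ} {z : ℕ} (hz : z ∉ Q) : setSum (Q ∪ {z}) = setSum Q + z := by
  rw [setSum, setSum, Finset.sum_union (by simpa using hz)]; simp

lemma notMem_parts {χ : ℕ → Fin k} {j' j'' : Fin k} (hj : j' ≠ j'') {z : ℕ}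
    (hz : z ∈ parts n χ j') : z ∉ parts n χ j'' := fun h => by
  rw [mem_parts] at hz h
  exact hj (hz.2.symm.trans h.2)

lemma sum_card_parts (χ : ℕ → Fin k) : ∑ j, ((parts n χ j).card : ℝ) = n := by
  have := Finset.card_eq_sum_card_fiberwise (s := Finset.Icc 1 n) (t := Finset.univ) (f := χ)
    fun _ _ => Finset.mem_coe.mpr (Finset.mem_univ _)
  rw [Nat.card_Icc, Nat.add_sub_cancel] at this
  exact_mod_cast this.symm

lemma sum_setSum_parts (χ : ℕ → Fin k) :
    ∑ j, setSum (parts n χ j) = n * (n + 1) / 2 := by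
  have h1 := Finset.sum_fiberwise (Finset.Icc 1 n) χ fun z => (z : ℝ)
  have h2 : ∀ n : ℕ, ∑ z ∈ Finset.Icc 1 n, (z : ℝ) = n * (n + 1) / 2 := by
    intro n
    induction n with
    | zero => simp
    | succ n ih => rw [Finset.sum_Icc_succ_top (by omega), ih]; push_cast; ring
  rw [← h2, ← h1]
  refine Finset.sum_congr rfl fun j _ => ?_
  rw [setSum]; push_cast; rfl

lemma sum_le_of_two {f f' : Fin k → ℝ} {a b : Fin k} (hab : a ≠ b) {c : ℝ}
    (h : ∀ j, j ≠ a → j ≠ b → f' j ≤ f j) (ha : f' a ≤ f a + c) (hb : f' b ≤ f b + c) :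
    ∑ j, f' j ≤ ∑ j, f j + 2 * c := by
  have : ∀ j, f' j ≤ f j + ((if j = a then c else 0) + (if j = b then c else 0)) := fun j => by
    by_cases h1 : j = a
    · subst h1; simpa [hab] using ha
    by_cases h2 : j = b
    · subst h2; simpa [h1] using hb
    simpa [h1, h2] using h j h1 h2
  refine (Finset.sum_le_sum fun j _ => this j).trans ?_
  simp [Finset.sum_add_distrib]
  linarith

/-- Sum the inequality |x j| ≤ 2 M - x j. -/
lemma sum_abs_le {x : Fin k → ℝ} (h0 : ∑ j, x j = 0) {M : ℝ} (hM : 0 ≤ M) (h : ∀ j, x j ≤ M) :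
    ∑ j, |x j| ≤ 2 * k * M := by
  have : ∀ j, |x j| ≤ 2 * M - x j := fun j => abs_le'.mpr ⟨by linarith [h j], by linarith⟩
  refine (Finset.sum_le_sum fun j _ => this j).trans ?_
  rw [Finset.sum_sub_distrib, h0]
  simp
  linarith

/-- Indeed √E - √E' = (E - E') / (√E + √E') ≥ (E / K) / (2 √E) ≥ 1 / (2 K). As a potential the root
has the right scale: E of order n² allows order n steps. -/
lemma two_mul_sqrt_add_one_le {K E E' : ℝ} (hK : 0 < K) (hE : 1 ≤ E) (hE' : 0 ≤ E')
    (h : E' ≤ E - E / K) :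
    2 * K * √E' + 1 ≤ 2 * K * √E := by
  have ha : 1 ≤ √E := by rwa [Real.one_le_sqrt]
  have hb := Real.sqrt_nonneg E'
  have h1 := Real.sq_sqrt (by linarith : (0 : ℝ) ≤ E)
  have h2 := Real.sq_sqrt hE'
  have h3 : E ≤ K * (E - E') := by
    have := mul_le_mul_of_nonneg_left h hK.le
    rw [mul_sub, mul_div_cancel₀ _ hK.ne'] at this
    linarith
  have hba : √E' ≤ √E := Real.sqrt_le_sqrt (by have : 0 ≤ E / K := by positivity
                                               linarith)
  by_contra hcon
  push Not at hcon
  nlinarith [mul_nonneg hK.le (sub_nonneg.mpr hba)]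

end EqualSumPartition
namespace EqualSumPartition

/-! ### Deterministic analysis of the two loops -/

variable {n k : ℕ} {α : Fin k → ℚ}

/-- A bound for half the number of elements that the second loop moves when it starts with the
total deviation `E` and can always make exchanges with a difference of at least `H / 2`, or that
nearly exhaust the deviation of one of the two parts. -/
noncomputable def exchangeBudget (k : ℕ) (H E : ℝ) : ℝ := E / H + 2 * k * √E

lemma exchangeBudget_mono {H : ℝ} (hH : 0 < H) {E E' : ℝ} (h : E' ≤ E) :
    exchangeBudget k H E' ≤ exchangeBudget k H E := by
  unfold exchangeBudget
  have := Real.sqrt_le_sqrt h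
  gcongr

/-- The first term of the budget pays for steps that lower E by H, the second for steps that lower
it by the share 1/k. -/
lemma exchangeBudget_add_one_le {H : ℝ} (hH : 0 < H) (hk : 0 < k) {E E' : ℝ} (hE : 1 ≤ E)
    (hE' : 0 ≤ E') (hlt : E' ≤ E) (h : E' ≤ E - H ∨ E' ≤ E - E / k) :
    exchangeBudget k H E' + 1 ≤ exchangeBudget k H E := by
  have hk' : (0 : ℝ) < k := by exact_mod_cast hk
  unfold exchangeBudget
  rcases h with h | h
  · have h1 : E' / H + 1 ≤ E / H := by
      rw [div_add_one hH.ne']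
      gcongr
      linarith
    have := mul_le_mul_of_nonneg_left (Real.sqrt_le_sqrt hlt) (by positivity : 0 ≤ 2 * (k : ℝ))
    linarith
  · have h1 := two_mul_sqrt_add_one_le hk' hE hE' h
    have : E' / H ≤ E / H := by gcongr
    linarith

lemma IsMember.targetSum_nat (hm : IsMember α n) : ∃ s : ℕ, targetSum n k = s := by
  obtain ⟨s, hs⟩ := hm.dvd
  refine ⟨s, ?_⟩
  have h2 : n * (n + 1) = 2 * (k * s) := by
    rw [← hs, Nat.mul_div_cancel' (Nat.even_mul_succ_self n).two_dvd]
  have hk : k ≠ 0 := by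
    rintro rfl
    have := hm.pos
    simp at h2
    omega
  have h2' : (n : ℝ) * (n + 1) = 2 * (k * s) := by exact_mod_cast h2
  have hk' : (k : ℝ) ≠ 0 := by exact_mod_cast hk
  rw [targetSum, h2']
  field_simp

lemma sum_targetSum (hk : 0 < k) : ∑ _j : Fin k, targetSum n k = n * (n + 1) / 2 := by
  have : (k : ℝ) ≠ 0 := by exact_mod_cast hk.ne'
  simp only [Finset.sum_const, Finset.card_univ, Fintype.card_fin, nsmul_eq_mul, targetSum]
  field_simp

lemma sum_setSum_sub (hk : 0 < k) (χ : ℕ → Fin k) :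
    ∑ j, (setSum (parts n χ j) - targetSum n k) = 0 := by
  rw [Finset.sum_sub_distrib, sum_setSum_parts, sum_targetSum hk, sub_self]

lemma isEqualSumPartition_parts {χ : ℕ → Fin k}
    (hcard : ∀ j, ((parts n χ j).card : ℝ) = (α j : ℝ) * n)
    (hsum : ∀ j, setSum (parts n χ j) = targetSum n k) :
    IsEqualSumPartition α n (parts n χ) where
  disjoint j j' hj := Finset.disjoint_left.mpr fun _ h => notMem_parts hj h
  union := by
    ext z
    simp [mem_parts]
  card := hcard
  sum := hsum

lemma Succeeds.of_sums_eq {χ : ℕ → Fin k}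
    (hcard : ∀ j, ((parts n χ j).card : ℝ) = (α j : ℝ) * n)
    (hsum : ∀ j, setSum (parts n χ j) = targetSum n k) :
    Succeeds α n (.balancing (parts n χ)) := by
  refine .step _ ⟨_, .finish _ hsum⟩ fun c' hc' => ?_
  cases hc' with
  | exchange Q j' j'' z' z'' h => exact absurd (hsum h.choose) h.choose_spec
  | fail Q j' j'' h => exact absurd (hsum h.choose) h.choose_spec
  | finish Q h => exact .returned _ (isEqualSumPartition_parts hcard hsum)

lemma sumDeviation_nonneg (χ : ℕ → Fin k) : 0 ≤ sumDeviation n χ :=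
  Finset.sum_nonneg fun _ _ => abs_nonneg _

lemma sums_eq_of_sumDeviation_eq_zero {χ : ℕ → Fin k} (h : sumDeviation n χ = 0) (j : Fin k) :
    setSum (parts n χ j) = targetSum n k := by
  have := (Finset.sum_eq_zero_iff_of_nonneg fun _ _ => abs_nonneg _).mp h j (Finset.mem_univ j)
  linarith [abs_eq_zero.mp this]

/-- The two parts chosen by the second loop lie on different sides of the target sum, and both
deviate from it by at least one and by a definite share of the total deviation. -/
lemma SumPair.deviation (hm : IsMember α n) {χ : ℕ → Fin k} {j' j'' : Fin k}
    (hj : SumPair (parts n χ) j' j'') (h : ∃ j, setSum (parts n χ j) ≠ targetSum n k) :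
    j' ≠ j'' ∧ ∃ Δ : ℕ, 1 ≤ Δ ∧ sumDeviation n χ ≤ 2 * k * Δ ∧
      min (setSum (parts n χ j') - targetSum n k) (targetSum n k - setSum (parts n χ j'')) = Δ := by
  have hk : 0 < k := Fin.pos j'
  have hk' : (0 : ℝ) < k := by exact_mod_cast hk
  have h0 := sum_setSum_sub (n := n) hk χ
  have hE : 0 < sumDeviation n χ := by
    refine lt_of_le_of_ne (sumDeviation_nonneg χ) fun e => ?_
    obtain ⟨j, hj⟩ := h
    exact hj (sums_eq_of_sumDeviation_eq_zero e.symm j)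
  obtain ⟨s, hs⟩ := hm.targetSum_nat
  set M := setSum (parts n χ j') - targetSum n k with hM
  set L := targetSum n k - setSum (parts n χ j'') with hL
  have hMle : ∀ j, setSum (parts n χ j) - targetSum n k ≤ M := fun j => by
    have := hj.1 j; simp only [hM]; linarith
  have hLle : ∀ j, -(setSum (parts n χ j) - targetSum n k) ≤ L := fun j => by
    have := hj.2 j; simp only [hL]; linarith
  have h0' : ∑ j, -(setSum (parts n χ j) - targetSum n k) = 0 := by
    rw [Finset.sum_neg_distrib, h0, neg_zero]
  have hM0 : 0 ≤ M := by
    have := Finset.sum_le_sum fun j (_ : j ∈ Finset.univ) => hMle j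
    rw [h0] at this
    simp at this
    exact nonneg_of_mul_nonneg_right this hk'
  have hL0 : 0 ≤ L := by
    have := Finset.sum_le_sum fun j (_ : j ∈ Finset.univ) => hLle j
    rw [h0'] at this
    simp at this
    exact nonneg_of_mul_nonneg_right this hk'
  have hEM : sumDeviation n χ ≤ 2 * k * M := sum_abs_le h0 hM0 hMle
  have hEL : sumDeviation n χ ≤ 2 * k * L := by
    have := sum_abs_le h0' hL0 hLle
    simpa only [abs_neg, sumDeviation] using this
  have hMpos : 0 < M := by
    by_contra hcon
    nlinarith
  have hLpos : 0 < L := by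
    by_contra hcon
    nlinarith
  have hne : j' ≠ j'' := by
    rintro rfl
    linarith
  -- The subtractions in ℕ are not truncated, since M and L are positive.
  refine ⟨hne, min (∑ z ∈ parts n χ j', z - s) (s - ∑ z ∈ parts n χ j'', z), ?_⟩
  rw [hM, hs, setSum, sub_pos, Nat.cast_lt] at hMpos
  rw [hL, hs, setSum, sub_pos, Nat.cast_lt] at hLpos
  have e : min M L =
      ((min (∑ z ∈ parts n χ j', z - s) (s - ∑ z ∈ parts n χ j'', z) : ℕ) : ℝ) := by
    rw [Nat.cast_min, Nat.cast_sub hMpos.le, Nat.cast_sub hLpos.le, hM, hL, hs, setSum, setSum]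
  refine ⟨by omega, ?_, e⟩
  rw [← e]
  rcases min_choice M L with h | h <;> rw [h] <;> assumption

lemma exists_sumPair (hk : 0 < k) (Q : Fin k → Finset ℕ) : ∃ j' j'', SumPair Q j' j'' := by
  have : Nonempty (Fin k) := ⟨⟨0, hk⟩⟩
  obtain ⟨j', h'⟩ := Finite.exists_max fun j => setSum (Q j)
  obtain ⟨j'', h''⟩ := Finite.exists_min fun j => setSum (Q j)
  exact ⟨j', j'', h', h''⟩

open Classical in
lemma exists_max_exchangeable {Q : Fin k → Finset ℕ} {j' j'' : Fin k}
    (h : ∃ z' z'', Exchangeable n Q j' j'' z' z'') :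
    ∃ z' z'', Exchangeable n Q j' j'' z' z'' ∧ ∀ w' w'', Exchangeable n Q j' j'' w' w'' →
        (w' : ℝ) - (w'' : ℝ) ≤ (z' : ℝ) - (z'' : ℝ) := by
  obtain ⟨z', z'', hz⟩ := h
  obtain ⟨p, hp, hmax⟩ := Finset.exists_max_image
    ((Q j' ×ˢ Q j'').filter fun p => Exchangeable n Q j' j'' p.1 p.2)
    (fun p => (p.1 : ℝ) - p.2)
    ⟨(z', z''), Finset.mem_filter.mpr ⟨Finset.mk_mem_product hz.1 hz.2.1, hz⟩⟩
  refine ⟨p.1, p.2, (Finset.mem_filter.mp hp).2, fun w' w'' hw => hmax (w', w'') ?_⟩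
  exact Finset.mem_filter.mpr ⟨Finset.mk_mem_product hw.1 hw.2.1, hw⟩

/-- A difference of at most Δ carries neither sum past the target, so both deviations fall by
exactly this difference. -/
lemma sumDeviation_exchange {χ : ℕ → Fin k} {j' j'' : Fin k} (hj : j' ≠ j'') {z' z'' : ℕ}
    (hz : Exchangeable n (parts n χ) j' j'' z' z'') :
    sumDeviation n (Function.update (Function.update χ z' j'') z'' j') ≤
      sumDeviation n χ - 2 * (z' - z'') := by
  obtain ⟨hz', hz'', hpos, hle⟩ := hz
  have hle1 := hle.trans (min_le_left _ _)
  have hle2 := hle.trans (min_le_right _ _)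
  have hne : z' ≠ z'' := fun e => by rw [e, sub_self] at hpos; exact lt_irrefl _ hpos
  have h := sum_le_of_two (f := fun j => |setSum (parts n χ j) - targetSum n k|)
    (f' := fun j => |setSum (parts n (Function.update (Function.update χ z' j'') z'' j') j) -
      targetSum n k|) hj (c := -((z' : ℝ) - z'')) ?_ ?_ ?_
  · unfold sumDeviation; linarith
  · intro j h1 h2
    simp only [parts_exchange hj hz' hz'', Function.update_of_ne h2, Function.update_of_ne h1,
      le_refl]
  · simp only [parts_exchange hj hz' hz'', Function.update_of_ne hj, Function.update_self]
    rw [setSum_union (by simp [notMem_parts hj.symm hz'']), setSum_sdiff hz',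
      abs_of_nonneg (by linarith), abs_of_nonneg (by linarith)]
    linarith
  · simp only [parts_exchange hj hz' hz'', Function.update_self]
    rw [setSum_union (by simp [notMem_parts hj hz']), setSum_sdiff hz'',
      abs_of_nonpos (by linarith), abs_of_nonpos (by linarith)]
    linarith

lemma card_exchange {χ : ℕ → Fin k} {j' j'' : Fin k} (hj : j' ≠ j'') {z' z'' : ℕ}
    (hz' : z' ∈ parts n χ j') (hz'' : z'' ∈ parts n χ j'') (j : Fin k) :
    ((parts n (Function.update (Function.update χ z' j'') z'' j') j).card : ℝ) =
      (parts n χ j).card := by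
  rw [parts_exchange hj hz' hz'']
  by_cases h2 : j = j''
  · subst h2
    rw [Function.update_self, card_union_singleton (by simp [notMem_parts hj hz']),
      card_move hz'']
    ring
  rw [Function.update_of_ne h2]
  by_cases h1 : j = j'
  · subst h1
    rw [Function.update_self, card_union_singleton (by simp [notMem_parts hj.symm hz'']),
      card_move hz']
    ring
  · rw [Function.update_of_ne h1]

/-- An exchange alters at most two more elements and lowers the budget by at least 1, so the
hypothesis on G is an invariant. Hence a pair with difference min Δ h always survives: failure is
impossible, and the maximal exchange is at least this large. Termination holds because the sum
deviation falls by at least 2 each time. -/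
theorem Succeeds.balancing (hm : IsMember α n) {h : ℕ} (hh : 1 ≤ h) {H : ℝ} (hH : 0 < H)
    (hHh : H ≤ 2 * h) {χ₀ : ℕ → Fin k} {G : ℝ} (hp : HasManyPairs n h G χ₀) (N : ℕ) :
    ∀ χ : ℕ → Fin k, sumDeviation n χ ≤ N →
      (∀ j, ((parts n χ j).card : ℝ) = (α j : ℝ) * n) →
      changes n χ₀ χ + 2 * exchangeBudget k H (sumDeviation n χ) < G →
      Succeeds α n (.balancing (parts n χ)) := by
  induction N with
  | zero =>
    intro χ hN hcard _
    rw [Nat.cast_zero] at hN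
    exact .of_sums_eq hcard fun j =>
      sums_eq_of_sumDeviation_eq_zero (le_antisymm hN (sumDeviation_nonneg χ)) j
  | succ N ih =>
    intro χ hN hcard hG
    by_cases hne : ∃ j, setSum (parts n χ j) ≠ targetSum n k
    swap
    · push Not at hne
      exact .of_sums_eq hcard hne
    have hk : 0 < k := Fin.pos hne.choose
    have hk' : (0 : ℝ) < k := by exact_mod_cast hk
    have hG' : (changes n χ₀ χ : ℝ) < G := by
      have : 0 ≤ exchangeBudget k H (sumDeviation n χ) := by
        have := sumDeviation_nonneg (n := n) χ
        unfold exchangeBudget; positivity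
      linarith
    have key : ∀ j' j'', SumPair (parts n χ) j' j'' → j' ≠ j'' ∧ ∃ Δ : ℕ, 1 ≤ Δ ∧
        sumDeviation n χ ≤ 2 * k * Δ ∧ ∃ z' z'', Exchangeable n (parts n χ) j' j'' z' z'' ∧
          (z' : ℝ) - z'' = min Δ h := by
      intro j' j'' hj
      obtain ⟨hjj, Δ, hΔ1, hΔE, hΔ⟩ := hj.deviation hm hne
      refine ⟨hjj, Δ, hΔ1, hΔE, ?_⟩
      obtain ⟨z, hz', hz''⟩ := hp.exists_pair hG' (d := min Δ h) (by omega) (min_le_right _ _) hjj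
      refine ⟨z + min Δ h, z, ⟨hz', hz'', ?_, ?_⟩, by push_cast; ring⟩
      · have : (0 : ℝ) < ((min Δ h : ℕ) : ℝ) := by
          exact_mod_cast (by omega : 0 < min Δ h)
        push_cast at this ⊢
        linarith
      · rw [hΔ]
        push_cast
        linarith [min_le_left (Δ : ℝ) h]
    refine .step _ ?_ fun c' hc' => ?_
    · obtain ⟨j', j'', hj⟩ := exists_sumPair hk (parts n χ)
      obtain ⟨-, Δ, -, -, z', z'', hz, -⟩ := key j' j'' hj
      obtain ⟨w', w'', hw, hmax⟩ := exists_max_exchangeable ⟨z', z'', hz⟩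
      exact ⟨_, .exchange _ j' j'' w' w'' hne hj hw hmax⟩
    cases hc' with
    | finish Q hs => exact absurd (hs hne.choose) hne.choose_spec
    | fail Q j' j'' _ hj hz =>
      obtain ⟨-, Δ, -, -, z', z'', hz', -⟩ := key j' j'' hj
      exact absurd ⟨z', z'', hz'⟩ hz
    | exchange Q j' j'' z' z'' _ hj hz hmax =>
      obtain ⟨hjj, Δ, hΔ1, hΔE, w', w'', hw, hww⟩ := key j' j'' hj
      have hd := hmax w' w'' hw
      rw [hww, Nat.cast_min] at hd
      rw [← parts_exchange hjj hz.1 hz.2.1]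
      have hE' := sumDeviation_exchange hjj hz
      have hE'0 := sumDeviation_nonneg (n := n)
        (Function.update (Function.update χ z' j'') z'' j')
      have hd1 : (1 : ℝ) ≤ min (Δ : ℝ) h := by
        rw [le_min_iff]; exact ⟨by exact_mod_cast hΔ1, by exact_mod_cast hh⟩
      refine ih _ ?_ (fun j => (card_exchange hjj hz.1 hz.2.1 j).trans (hcard j)) ?_
      · push_cast at hN; linarith
      · have hB : exchangeBudget k H
            (sumDeviation n (Function.update (Function.update χ z' j'') z'' j')) + 1 ≤
            exchangeBudget k H (sumDeviation n χ) := by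
          refine exchangeBudget_add_one_le hH hk (by linarith) hE'0 (by linarith) ?_
          -- A difference of at least Δ lowers the deviation by 2 Δ ≥ E / k, one of at least h
          -- lowers it by 2 h ≥ H.
          rcases min_choice (Δ : ℝ) h with e | e
          · right
            have : sumDeviation n χ / k ≤ 2 * Δ := by
              rw [div_le_iff₀ hk']; linarith
            rw [e] at hd
            linarith
          · left
            rw [e] at hd
            linarith
        have hc : (changes n χ₀ (Function.update (Function.update χ z' j'') z'' j') : ℝ) ≤
            changes n χ₀ χ + 2 := by
          exact_mod_cast (changes_update_le χ₀ _ z'' j').trans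
            (Nat.add_le_add_right (changes_update_le χ₀ χ z' j'') 1)
        linarith

/-- A move lowers the size deviation by at least 2, adds at most 1 to the changes and at most 2 n to
the sum deviation. So the combinations bounded by a and b never grow, and at the exit they bound
what the second loop starts with. -/
theorem Succeeds.sizing (hα : ∑ j, (α j : ℝ) = 1) (hm : IsMember α n) {h : ℕ} (hh : 1 ≤ h)
    {H : ℝ} (hH : 0 < H) (hHh : H ≤ 2 * h) {χ₀ : ℕ → Fin k} {G : ℝ} (hp : HasManyPairs n h G χ₀)
    {a b : ℝ} (hab : a + 2 * exchangeBudget k H b < G) (N : ℕ) :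
    ∀ χ : ℕ → Fin k, sizeDeviation α n χ ≤ N →
      changes n χ₀ χ + sizeDeviation α n χ / 2 ≤ a →
      sumDeviation n χ + n * sizeDeviation α n χ ≤ b →
      Succeeds α n (.sizing (parts n χ)) := by
  have hdone : ∀ χ : ℕ → Fin k, changes n χ₀ χ + sizeDeviation α n χ / 2 ≤ a →
      sumDeviation n χ + n * sizeDeviation α n χ ≤ b →
      (¬ ∃ j' j'', SizePair α n (parts n χ) j' j'') →
      Succeeds α n (.balancing (parts n χ)) := by
    intro χ ha hb hno
    have hF : 0 ≤ sizeDeviation α n χ := Finset.sum_nonneg fun _ _ => abs_nonneg _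
    have h0 : ∑ j, (((parts n χ j).card : ℝ) - (α j : ℝ) * n) = 0 := by
      rw [Finset.sum_sub_distrib, sum_card_parts, ← Finset.sum_mul, hα, one_mul, sub_self]
    have hcard : ∀ j, ((parts n χ j).card : ℝ) = (α j : ℝ) * n := by
      -- Without a pair to move between, all deviations have the same sign; as they sum to 0, they
      -- vanish.
      have hall : (∀ j, ((parts n χ j).card : ℝ) - (α j : ℝ) * n ≤ 0) ∨
          ∀ j, 0 ≤ ((parts n χ j).card : ℝ) - (α j : ℝ) * n := by
        by_contra hcon
        push Not at hcon
        obtain ⟨⟨j', h'⟩, j'', h''⟩ := hcon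
        exact hno ⟨j', j'', by linarith, by linarith⟩
      intro j
      rcases hall with hall | hall
      · linarith [(Finset.sum_eq_zero_iff_of_nonpos fun j _ => hall j).mp h0 j
          (Finset.mem_univ j)]
      · linarith [(Finset.sum_eq_zero_iff_of_nonneg fun j _ => hall j).mp h0 j
          (Finset.mem_univ j)]
    obtain ⟨N, hN⟩ := exists_nat_ge (sumDeviation n χ)
    refine .balancing hm hh hH hHh hp N χ hN hcard ?_
    have := exchangeBudget_mono (k := k) hH (E' := sumDeviation n χ) (E := b) (by
      have : 0 ≤ n * sizeDeviation α n χ := by positivity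
      linarith)
    linarith
  have hmove : ∀ (χ : ℕ → Fin k) (j' j'' : Fin k) (z : ℕ),
      SizePair α n (parts n χ) j' j'' → z ∈ parts n χ j' →
      j' ≠ j'' ∧ sizeDeviation α n (Function.update χ z j'') ≤ sizeDeviation α n χ - 2 ∧
      sumDeviation n (Function.update χ z j'') ≤ sumDeviation n χ + 2 * n := by
    intro χ j' j'' z hj hz
    obtain ⟨h1, h2⟩ := hj
    have hjj : j' ≠ j'' := by
      rintro rfl
      exact lt_asymm h1 h2
    have hzn : (z : ℝ) ≤ n := by exact_mod_cast (mem_parts.mp hz).1.2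
    have hz0 : (0 : ℝ) ≤ z := by positivity
    have hnot := notMem_parts hjj hz
    have hnat : ∀ j, ∃ p : ℕ, (α j : ℝ) * n = p := fun j => by
      obtain ⟨p, hp⟩ := hm.integral j
      exact ⟨p, by exact_mod_cast hp⟩
    refine ⟨hjj, ?_, ?_⟩
    · have := sum_le_of_two (f := fun j => |((parts n χ j).card : ℝ) - (α j : ℝ) * n|)
        (f' := fun j => |((parts n (Function.update χ z j'') j).card : ℝ) - (α j : ℝ) * n|)
        hjj (c := -1) ?_ ?_ ?_
      · unfold sizeDeviation; linarith
      · intro j e1 e2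
        simp only [parts_update hjj hz, Function.update_of_ne e2, Function.update_of_ne e1,
          le_refl]
      · simp only [parts_update hjj hz, Function.update_of_ne hjj, Function.update_self]
        rw [card_move hz]
        -- The prescribed size is an integer, so the excess is at least 1 and the move does not
        -- overshoot.
        obtain ⟨p, hp⟩ := hnat j'
        rw [hp] at h1 ⊢
        have : ((p : ℝ) + 1) ≤ (parts n χ j').card := by exact_mod_cast h1
        rw [abs_of_nonneg (by linarith), abs_of_nonneg (by linarith)]
        linarith
      · simp only [parts_update hjj hz, Function.update_self]
        rw [card_union_singleton hnot]
        obtain ⟨p, hp⟩ := hnat j''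
        rw [hp] at h2 ⊢
        have : ((parts n χ j'').card : ℝ) + 1 ≤ p := by exact_mod_cast h2
        rw [abs_of_nonpos (by linarith), abs_of_nonpos (by linarith)]
        linarith
    · refine sum_le_of_two (f := fun j => |setSum (parts n χ j) - targetSum n k|)
        (f' := fun j => |setSum (parts n (Function.update χ z j'') j) - targetSum n k|)
        hjj (c := n) ?_ ?_ ?_
      · intro j e1 e2
        simp only [parts_update hjj hz, Function.update_of_ne e2, Function.update_of_ne e1,
          le_refl]
      · simp only [parts_update hjj hz, Function.update_of_ne hjj, Function.update_self]
        rw [setSum_sdiff hz]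
        refine abs_le'.mpr ⟨?_, ?_⟩
        · linarith [le_abs_self (setSum (parts n χ j') - targetSum n k)]
        · linarith [neg_abs_le (setSum (parts n χ j') - targetSum n k)]
      · simp only [parts_update hjj hz, Function.update_self]
        rw [setSum_union hnot]
        refine abs_le'.mpr ⟨?_, ?_⟩
        · linarith [le_abs_self (setSum (parts n χ j'') - targetSum n k)]
        · linarith [neg_abs_le (setSum (parts n χ j'') - targetSum n k)]
  have hstep : ∀ χ : ℕ → Fin k, changes n χ₀ χ + sizeDeviation α n χ / 2 ≤ a →
      sumDeviation n χ + n * sizeDeviation α n χ ≤ b →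
      (∀ χ' : ℕ → Fin k, sizeDeviation α n χ' ≤ sizeDeviation α n χ - 2 →
        changes n χ₀ χ' + sizeDeviation α n χ' / 2 ≤ a →
        sumDeviation n χ' + n * sizeDeviation α n χ' ≤ b →
        Succeeds α n (.sizing (parts n χ'))) →
      Succeeds α n (.sizing (parts n χ)) := by
    intro χ ha hb ih
    refine .step _ ?_ fun c' hc' => ?_
    · by_cases hex : ∃ j' j'', SizePair α n (parts n χ) j' j''
      · obtain ⟨j', j'', hj⟩ := hex
        have hpos : 0 < (parts n χ j').card := by
          obtain ⟨p, hp⟩ := hm.integral j'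
          have hp' : (α j' : ℝ) * n = p := by exact_mod_cast hp
          have := hj.1
          rw [hp', Nat.cast_lt] at this
          omega
        obtain ⟨z, hz⟩ := Finset.card_pos.mp hpos
        exact ⟨_, .move _ j' j'' z hj hz⟩
      · exact ⟨_, .sized _ hex⟩
    cases hc' with
    | sized Q hno => exact hdone χ ha hb hno
    | move Q j' j'' z hj hz =>
      obtain ⟨hjj, h1, h2⟩ := hmove χ j' j'' z hj hz
      rw [← parts_update hjj hz]
      refine ih _ h1 ?_ ?_
      · have : (changes n χ₀ (Function.update χ z j'') : ℝ) ≤ changes n χ₀ χ + 1 := by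
          exact_mod_cast changes_update_le χ₀ χ z j''
        linarith
      · have := mul_le_mul_of_nonneg_left h1 (by positivity : (0 : ℝ) ≤ n)
        linarith
  induction N with
  | zero =>
    intro χ hN ha hb
    refine hstep χ ha hb fun χ' h' => ?_
    have : 0 ≤ sizeDeviation α n χ' := Finset.sum_nonneg fun _ _ => abs_nonneg _
    rw [Nat.cast_zero] at hN
    linarith
  | succ N ih =>
    intro χ hN ha hb
    refine hstep χ ha hb fun χ' h' => ih χ' ?_
    push_cast at hN
    linarith

end EqualSumPartition
namespace EqualSumPartition

open MeasureTheory ProbabilityTheory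

/-! ### Concentration for product measures -/

section Concentration

variable {I E : Type*} [Fintype I] [DecidableEq I] [Nonempty E] [Finite E]
  [MeasurableSpace E] [MeasurableSingletonClass E] {ν : I → Measure E}
  [∀ i, IsProbabilityMeasure (ν i)]

/-- Both functions factor through restrictions to disjoint sets of coordinates, and these are
independent. -/
lemma indepFun_of_dependsOn {f g : (I → E) → ℝ} {S T : Finset I} (hST : Disjoint S T)
    (hf : DependsOn f S) (hg : DependsOn g T) : IndepFun f g (Measure.pi ν) := by
  have hind : iIndepFun (fun i (X : I → E) => X i) (Measure.pi ν) :=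
    iIndepFun_pi (X := fun _ e => e) fun _ => aemeasurable_id
  have h := hind.indepFun_finset S T hST fun i => measurable_pi_apply i
  obtain ⟨e⟩ := ‹Nonempty E›
  have hfac : ∀ (u : (I → E) → ℝ) (U : Finset I), DependsOn u U →
      u = (fun y : U → E => u fun i => if hi : i ∈ U then y ⟨i, hi⟩ else e) ∘
        fun (X : I → E) (i : U) => X i := fun u U hu => by
    funext X
    refine hu fun i hi => ?_
    have hi' : i ∈ U := hi
    simp [hi']
  rw [hfac f S hf, hfac g T hg]
  exact h.comp .of_discrete .of_discrete

/-- Hoeffding's lemma gives each summand the variance proxy 1/4, and proxies add under independence.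
-/
lemma hasSubgaussianMGF_sum {ι : Type*} {g : ι → (I → E) → ℝ} {S : ι → Finset I}
    (hS : Pairwise fun i j => Disjoint (S i) (S j)) (hg : ∀ i, DependsOn (g i) (S i))
    (h01 : ∀ i X, g i X ∈ Set.Icc (0 : ℝ) 1) (s : Finset ι) :
    HasSubgaussianMGF (fun X => ∑ i ∈ s, (g i X - ∫ Y, g i Y ∂Measure.pi ν))
      (s.card / 4) (Measure.pi ν) := by
  classical
  induction s using Finset.induction_on with
  | empty => simp
  | insert a s ha ih =>
    have h1 := hasSubgaussianMGF_of_mem_Icc (μ := Measure.pi ν) (X := g a) (a := 0) (b := 1)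
      (Measurable.of_discrete).aemeasurable (.of_forall (h01 a))
    have hind : IndepFun (fun X => g a X - ∫ Y, g a Y ∂Measure.pi ν)
        (fun X => ∑ i ∈ s, (g i X - ∫ Y, g i Y ∂Measure.pi ν)) (Measure.pi ν) := by
      refine indepFun_of_dependsOn (S := S a) (T := s.biUnion S) ?_ ?_ ?_
      · rw [Finset.disjoint_biUnion_right]
        exact fun i hi => hS fun e => ha (e ▸ hi)
      · exact fun X Y h => by rw [hg a h]
      · intro X Y h
        refine Finset.sum_congr rfl fun i hi => ?_
        rw [hg i fun j hj => h j (Finset.mem_coe.mpr (Finset.mem_biUnion.mpr ⟨i, hi, hj⟩))]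
    have h2 := h1.add_of_indepFun ih hind
    have hc : ((‖(1 : ℝ) - 0‖₊ / 2) ^ 2 + s.card / 4 : NNReal) =
        ((insert a s).card : NNReal) / 4 := by
      rw [Finset.card_insert_of_notMem ha]
      ext
      push_cast
      norm_num
      ring
    rw [hc] at h2
    refine h2.congr (.of_forall fun X => ?_)
    simp [Finset.sum_insert ha]

/-- Hoeffding's inequality for functions of disjoint sets of coordinates. -/
lemma measure_abs_sum_ge_le {ι : Type*} [Fintype ι] {g : ι → (I → E) → ℝ} {S : ι → Finset I}
    (hS : Pairwise fun i j => Disjoint (S i) (S j)) (hg : ∀ i, DependsOn (g i) (S i))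
    (h01 : ∀ i X, g i X ∈ Set.Icc (0 : ℝ) 1) {τ : ℝ} (hτ : 0 ≤ τ) :
    (Measure.pi ν).real {X | τ * Fintype.card ι ≤
        |∑ i, g i X - ∑ i, ∫ Y, g i Y ∂Measure.pi ν|} ≤
      2 * Real.exp (-(2 * τ ^ 2 * Fintype.card ι)) := by
  have h := hasSubgaussianMGF_sum (ν := ν) hS hg h01 Finset.univ
  have hc : ((((Finset.univ : Finset ι).card : NNReal) / 4 : NNReal) : ℝ) =
      (Fintype.card ι : ℝ) / 4 := by
    rw [Finset.card_univ]; push_cast; rfl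
  have hpos : 0 ≤ τ * (Fintype.card ι : ℝ) := by positivity
  have he : -(τ * (Fintype.card ι : ℝ)) ^ 2 / (2 * ((Fintype.card ι : ℝ) / 4)) =
      -(2 * τ ^ 2 * Fintype.card ι) := by
    -- For an empty family both sides are 0, by the convention for division by 0.
    rcases eq_or_ne (Fintype.card ι : ℝ) 0 with h0 | h0
    · rw [h0]; simp
    · field_simp; ring
  have h1 := h.measure_ge_le hpos
  have h2 := h.neg.measure_ge_le hpos
  rw [hc, he] at h1 h2
  have hsub : {X | τ * Fintype.card ι ≤ |∑ i, g i X - ∑ i, ∫ Y, g i Y ∂Measure.pi ν|} ⊆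
      {X | τ * Fintype.card ι ≤ ∑ i, (g i X - ∫ Y, g i Y ∂Measure.pi ν)} ∪
      {X | τ * Fintype.card ι ≤
        (-fun X => ∑ i, (g i X - ∫ Y, g i Y ∂Measure.pi ν)) X} := by
    intro X hX
    simp only [Set.mem_union, Set.mem_ofPred_eq, Pi.neg_apply, Finset.sum_sub_distrib] at hX ⊢
    exact le_abs.mp hX
  refine (measureReal_mono hsub).trans ((measureReal_union_le _ _).trans ?_)
  linarith

end Concentration

/-! ### The rounding law -/

section RoundingLaw

variable {n k : ℕ} {x : Fin n → Fin k → ℝ}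

/-- The law of a single random choice. -/
noncomputable def choiceLaw (x : Fin n → Fin k → ℝ) (i : Fin n) : Measure (Fin k) :=
  ∑ j, ENNReal.ofReal (x i j) • Measure.dirac j

lemma isProbabilityMeasure_choiceLaw (h0 : ∀ i j, 0 ≤ x i j) (h1 : ∀ i, ∑ j, x i j = 1)
    (i : Fin n) : IsProbabilityMeasure (choiceLaw x i) := by
  refine ⟨?_⟩
  simp only [choiceLaw, Measure.coe_finsetSum, Finset.sum_apply, Measure.smul_apply,
    measure_univ, smul_eq_mul, mul_one]
  rw [← ENNReal.ofReal_sum_of_nonneg fun j _ => h0 i j, h1, ENNReal.ofReal_one]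

lemma integral_choiceLaw (h0 : ∀ i j, 0 ≤ x i j) (i : Fin n) (f : Fin k → ℝ) :
    ∫ j, f j ∂choiceLaw x i = ∑ j, x i j * f j := by
  rw [choiceLaw, integral_finsetSum_measure]
  · refine Finset.sum_congr rfl fun j _ => ?_
    rw [integral_smul_measure, integral_dirac, ENNReal.toReal_ofReal (h0 i j), smul_eq_mul]
  · intro j _
    exact Integrable.smul_measure (integrable_dirac (by simp)) ENNReal.ofReal_ne_top

lemma integral_roundingLaw (h0 : ∀ i j, 0 ≤ x i j) (h1 : ∀ i, ∑ j, x i j = 1) (i : Fin n)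
    (f : Fin k → ℝ) : ∫ X, f (X i) ∂roundingLaw x = ∑ j, x i j * f j := by
  have := isProbabilityMeasure_choiceLaw h0 h1
  have hmp := measurePreserving_eval (choiceLaw x) i
  rw [← integral_choiceLaw h0, ← hmp.map_eq,
    integral_map hmp.aemeasurable (Measurable.of_discrete).aestronglyMeasurable]
  rfl

lemma integral_indicator (h0 : ∀ i j, 0 ≤ x i j) (h1 : ∀ i, ∑ j, x i j = 1) (i : Fin n)
    (j : Fin k) (w : ℝ) : ∫ X, (if X i = j then w else 0) ∂roundingLaw x = w * x i j := by
  rw [integral_roundingLaw h0 h1 i fun a => if a = j then w else 0]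
  simp [mul_comm]

lemma dependsOn_eval (i : Fin n) (f : Fin k → ℝ) :
    DependsOn (fun X : Fin n → Fin k => f (X i)) (({i} : Finset (Fin n)) : Set (Fin n)) :=
  fun X Y h => by simp only [h i (by simp)]

lemma integral_indicator_pair [NeZero k] (h0 : ∀ i j, 0 ≤ x i j) (h1 : ∀ i, ∑ j, x i j = 1)
    {p q : Fin n} (hpq : p ≠ q) (a b : Fin k) :
    ∫ X, (if X p = a then (1 : ℝ) else 0) * (if X q = b then 1 else 0) ∂roundingLaw x =
      x p a * x q b := by
  have := isProbabilityMeasure_choiceLaw h0 h1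
  have hind := indepFun_of_dependsOn (ν := choiceLaw x) (S := {p}) (T := {q}) (by simpa using hpq)
    (dependsOn_eval p fun j : Fin k => if j = a then (1 : ℝ) else 0)
    (dependsOn_eval q fun j : Fin k => if j = b then (1 : ℝ) else 0)
  have := hind.integral_fun_mul_eq_mul_integral
    (Measurable.of_discrete).aestronglyMeasurable (Measurable.of_discrete).aestronglyMeasurable
  refine this.trans ?_
  change (∫ X, (if X p = a then (1 : ℝ) else 0) ∂roundingLaw x) *
    (∫ X, (if X q = b then (1 : ℝ) else 0) ∂roundingLaw x) = _
  rw [integral_indicator h0 h1, integral_indicator h0 h1, one_mul, one_mul]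

/-- The weights 1 serve for the sizes, the weights (n - i) / n for the sums scaled by 1 / n. -/
lemma measure_weighted_ge_le [NeZero k] (h0 : ∀ i j, 0 ≤ x i j) (h1 : ∀ i, ∑ j, x i j = 1)
    {w : Fin n → ℝ} (hw : ∀ i, w i ∈ Set.Icc (0 : ℝ) 1) (j : Fin k) {τ : ℝ} (hτ : 0 ≤ τ) :
    (roundingLaw x).real {X | τ * n ≤
        |∑ i, (if X i = j then w i else 0) - ∑ i, w i * x i j|} ≤
      2 * Real.exp (-(2 * τ ^ 2 * n)) := by
  have := isProbabilityMeasure_choiceLaw h0 h1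
  have h := measure_abs_sum_ge_le (ν := choiceLaw x) (S := fun i : Fin n => {i})
    (g := fun i (X : Fin n → Fin k) => if X i = j then w i else 0)
    (fun a b hab => by simpa using hab)
    (fun i => dependsOn_eval i fun a => if a = j then w i else 0)
    (fun i X => by
      split_ifs
      · exact hw i
      · simp) hτ
  have e : ∀ i, ∫ X : Fin n → Fin k, (if X i = j then w i else 0) ∂Measure.pi (choiceLaw x) =
      w i * x i j := fun i => integral_indicator h0 h1 i j (w i)
  simp only [e, Fintype.card_fin] at h
  exact h

/-- The number of indices `i` in a family of disjoint pairs of coordinates with `X (p i) = a` and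
`X (q i) = b` is concentrated. -/
lemma measure_pairs_ge_le [NeZero k] (h0 : ∀ i j, 0 ≤ x i j) (h1 : ∀ i, ∑ j, x i j = 1)
    {ι : Type*} [Fintype ι] {p q : ι → Fin n} (hp : p.Injective) (hq : q.Injective)
    (hpq : ∀ i j, p i ≠ q j) (a b : Fin k) {τ : ℝ} (hτ : 0 ≤ τ) :
    (roundingLaw x).real {X | τ * Fintype.card ι ≤
        |∑ i, (if X (p i) = a then (1 : ℝ) else 0) * (if X (q i) = b then 1 else 0) -
          ∑ i, x (p i) a * x (q i) b|} ≤
      2 * Real.exp (-(2 * τ ^ 2 * Fintype.card ι)) := by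
  have := isProbabilityMeasure_choiceLaw h0 h1
  have h := measure_abs_sum_ge_le (ν := choiceLaw x) (S := fun i : ι => {p i, q i})
    (g := fun i (X : Fin n → Fin k) =>
      (if X (p i) = a then (1 : ℝ) else 0) * (if X (q i) = b then 1 else 0))
    (fun i j hij => by
      simp [hp.ne hij.symm, hq.ne hij.symm, hpq, (hpq _ _).symm])
    (fun i X Y h => by simp only [h (p i) (by simp), h (q i) (by simp)])
    (fun i X => by
      split_ifs <;> simp) hτ
  have e : ∀ i, ∫ X : Fin n → Fin k, (if X (p i) = a then (1 : ℝ) else 0) *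
      (if X (q i) = b then 1 else 0) ∂Measure.pi (choiceLaw x) = x (p i) a * x (q i) b :=
    fun i => integral_indicator_pair h0 h1 (hpq i i) a b
  simp only [e] at h
  exact h

end RoundingLaw

end EqualSumPartition
namespace EqualSumPartition

open MeasureTheory ProbabilityTheory

/-! ### The assignment given by the random choices -/

/-- The index of the source container that stands for the element `z` of `[n]`. -/
def sourceOf {n : ℕ} (hn : 0 < n) (z : ℕ) : Fin n := ⟨n - max z 1, by omega⟩

variable {n k : ℕ}

lemma sourceOf_inj (hn : 0 < n) {z w : ℕ} (hz : 1 ≤ z) (hz' : z ≤ n) (hw : 1 ≤ w) (hw' : w ≤ n)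
    (h : sourceOf hn z = sourceOf hn w) : z = w := by
  have := congrArg Fin.val h
  simp only [sourceOf] at this
  omega

lemma initialSets_eq_parts (hn : 0 < n) (X : Fin n → Fin k) :
    initialSets X = parts n fun z => X (sourceOf hn z) := by
  funext j
  ext z
  simp only [initialSets, Finset.mem_image, Finset.mem_filter, Finset.mem_univ, true_and,
    mem_parts]
  constructor
  · rintro ⟨i, hi, rfl⟩
    have := i.isLt
    refine ⟨by omega, ?_⟩
    rw [← hi]
    congr 1
    ext
    simp only [sourceOf]
    omega
  · rintro ⟨⟨h1, h2⟩, h3⟩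
    refine ⟨_, h3, ?_⟩
    simp only [sourceOf]
    omega

lemma injective_sub_val : Function.Injective fun i : Fin n => n - i.val := fun i j h => by
  have := i.isLt
  have := j.isLt
  ext
  simp only at h
  omega

lemma card_parts_sourceOf (hn : 0 < n) (X : Fin n → Fin k) (j : Fin k) :
    ((parts n (fun z => X (sourceOf hn z)) j).card : ℝ) = ∑ i, if X i = j then (1 : ℝ) else 0 := by
  rw [← initialSets_eq_parts hn X, initialSets, Finset.card_image_of_injective _ injective_sub_val,
    Finset.sum_boole]

lemma setSum_parts_sourceOf (hn : 0 < n) (X : Fin n → Fin k) (j : Fin k) :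
    setSum (parts n (fun z => X (sourceOf hn z)) j) =
      n * ∑ i, if X i = j then ((n : ℝ) - i.val) / n else 0 := by
  have hn' : (n : ℝ) ≠ 0 := by exact_mod_cast hn.ne'
  rw [← initialSets_eq_parts hn X, initialSets, setSum,
    Finset.sum_image fun a _ b _ h => injective_sub_val h, Finset.mul_sum]
  push_cast
  rw [Finset.sum_filter]
  refine Finset.sum_congr rfl fun i _ => ?_
  split_ifs
  · rw [Nat.cast_sub i.isLt.le]; field_simp
  · rw [mul_zero]

/-! ### Disjoint pairs with a given difference -/

/-- The smaller elements of disjoint pairs in `[R]` with difference `d`. -/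
def lowerElements (R d : ℕ) : Finset ℕ := (Finset.Icc 1 (R - d)).filter fun z => Even ((z - 1) / d)

lemma mem_lowerElements {R d z : ℕ} :
    z ∈ lowerElements R d ↔ (1 ≤ z ∧ z ≤ R - d) ∧ Even ((z - 1) / d) := by
  simp [lowerElements]

lemma add_notMem_lowerElements {R d z : ℕ} (hd : 1 ≤ d) (hz : z ∈ lowerElements R d) :
    z + d ∉ lowerElements R d := by
  rw [mem_lowerElements] at hz ⊢
  rintro ⟨-, h⟩
  have e : z + d - 1 = z - 1 + d := by omega
  rw [e, Nat.add_div_right _ hd, Nat.even_add_one] at h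
  exact h hz.2

/-- Blocks of d consecutive integers are alternately taken and left out; the shift by d maps the
elements left out injectively into the block before, which is taken. -/
lemma le_two_mul_card_lowerElements {R d : ℕ} (hd : 1 ≤ d) :
    R - d ≤ 2 * (lowerElements R d).card := by
  have h := Finset.card_filter_add_card_filter_not (s := Finset.Icc 1 (R - d))
    (p := fun z => Even ((z - 1) / d))
  rw [Nat.card_Icc, Nat.add_sub_cancel] at h
  have hle : ((Finset.Icc 1 (R - d)).filter fun z => ¬ Even ((z - 1) / d)).card ≤
      (lowerElements R d).card := by
    refine Finset.card_le_card_of_injOn (fun z => z - d) ?_ ?_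
    · intro z hz
      simp only [Finset.coe_filter, Set.mem_ofPred_eq, Finset.mem_Icc] at hz
      obtain ⟨⟨h1, h2⟩, h3⟩ := hz
      have hdz : d ≤ z - 1 := by
        by_contra hlt
        rw [Nat.div_eq_of_lt (by omega)] at h3
        exact h3 Even.zero
      rw [Finset.mem_coe, mem_lowerElements]
      refine ⟨by simp only; omega, ?_⟩
      have e : z - 1 = (z - d - 1) + d := by omega
      rw [e, Nat.add_div_right _ hd, Nat.even_add_one, not_not] at h3
      exact h3
    · intro z hz w hw hzw
      simp only [Finset.coe_filter, Set.mem_ofPred_eq, Finset.mem_Icc] at hz hw hzw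
      have hdz : d ≤ z - 1 := by
        by_contra hlt
        rw [Nat.div_eq_of_lt (by omega)] at hz
        exact hz.2 Even.zero
      have hdw : d ≤ w - 1 := by
        by_contra hlt
        rw [Nat.div_eq_of_lt (by omega)] at hw
        exact hw.2 Even.zero
      omega
  change (lowerElements R d).card + _ = _ at h
  omega

/-- The number of pairs in `[R]` with difference `d` that the random choices put into the parts
`a` and `b`. -/
def pairCount (hn : 0 < n) (R d : ℕ) (X : Fin n → Fin k) (a b : Fin k) : ℝ :=
  ((lowerElements R d).filter fun z => X (sourceOf hn (z + d)) = a ∧ X (sourceOf hn z) = b).card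

lemma hasManyPairs_of_pairCount (hn : 0 < n) {R h : ℕ} (hR : R ≤ n) (hh : h ≤ R) {G : ℝ}
    {X : Fin n → Fin k}
    (hG : ∀ d a b, 1 ≤ d → d ≤ h → G ≤ pairCount hn R d X a b) :
    HasManyPairs n h G fun z => X (sourceOf hn z) := by
  intro d j' j'' h1 h2 _
  refine ⟨_, hG d j' j'' h1 h2, fun z hz => ?_, fun z hz w hw => ?_⟩
  · rw [Finset.mem_filter, mem_lowerElements] at hz
    exact ⟨hz.1.1.1, by omega, hz.2.2, hz.2.1⟩
  · rw [Finset.mem_filter] at hz hw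
    rintro rfl
    exact add_notMem_lowerElements h1 hz.1 hw.1

/-- The two choices of a pair are independent, so each pair counts with probability at least c ^ 2;
half of this expectation is given away as the deviation τ = c ^ 2 / 2. -/
lemma measure_pairCount_le [NeZero k] (hn : 0 < n) {R d : ℕ} (hR : R ≤ n) (hd : 1 ≤ d)
    {x : Fin n → Fin k → ℝ} (h0 : ∀ i j, 0 ≤ x i j) (h1 : ∀ i, ∑ j, x i j = 1) {c : ℝ}
    (hc : 0 ≤ c) (hx : ∀ i j, n - i.val ≤ R → c ≤ x i j) (a b : Fin k) :
    (roundingLaw x).real {X | pairCount hn R d X a b ≤ c ^ 2 / 2 * (lowerElements R d).card} ≤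
      2 * Real.exp (-(c ^ 4 / 2 * (lowerElements R d).card)) := by
  have := isProbabilityMeasure_choiceLaw h0 h1
  have : IsProbabilityMeasure (roundingLaw x) :=
    inferInstanceAs (IsProbabilityMeasure (Measure.pi (choiceLaw x)))
  have hmem := fun z : lowerElements R d => mem_lowerElements.mp z.2
  have hp : Function.Injective fun z : lowerElements R d => sourceOf hn (z.1 + d) :=
    fun z w hzw => by
      have := hmem z
      have := hmem w
      have := sourceOf_inj hn (by omega) (by omega) (by omega) (by omega) hzw
      ext
      omega
  have hq : Function.Injective fun z : lowerElements R d => sourceOf hn z.1 :=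
    fun z w hzw => by
      have := hmem z
      have := hmem w
      have := sourceOf_inj hn (by omega) (by omega) (by omega) (by omega) hzw
      ext
      omega
  have hpq : ∀ z w : lowerElements R d, sourceOf hn (z.1 + d) ≠ sourceOf hn w.1 :=
    fun z w hzw => by
      have := hmem z
      have := hmem w
      have := sourceOf_inj hn (by omega) (by omega) (by omega) (by omega) hzw
      exact add_notMem_lowerElements hd z.2 (this ▸ w.2)
  have h := measure_pairs_ge_le h0 h1 hp hq hpq a b (τ := c ^ 2 / 2) (by positivity)
  rw [Fintype.card_coe] at h
  refine (measureReal_mono fun X hX => ?_).trans (h.trans_eq ?_)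
  · simp only [Set.mem_ofPred_eq] at hX ⊢
    have hlow : (lowerElements R d).card * c ^ 2 ≤ ∑ z : lowerElements R d,
        x (sourceOf hn (z.1 + d)) a * x (sourceOf hn z.1) b := by
      have := Finset.card_nsmul_le_sum (Finset.univ : Finset (lowerElements R d))
        (fun z => x (sourceOf hn (z.1 + d)) a * x (sourceOf hn z.1) b) (c ^ 2) fun z _ => by
          have hz := hmem z
          rw [sq]
          refine mul_le_mul (hx _ _ ?_) (hx _ _ ?_) hc (h0 _ _)
          · simp only [sourceOf]; omega
          · simp only [sourceOf]; omega
      simpa [Finset.card_univ] using this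
    have hcount : ∑ z : lowerElements R d, (if X (sourceOf hn (z.1 + d)) = a then (1 : ℝ) else 0) *
        (if X (sourceOf hn z.1) = b then 1 else 0) = pairCount hn R d X a b := by
      rw [pairCount, Finset.sum_coe_sort (lowerElements R d) fun z =>
        (if X (sourceOf hn (z + d)) = a then (1 : ℝ) else 0) *
          (if X (sourceOf hn z) = b then 1 else 0), ← Finset.sum_boole]
      refine Finset.sum_congr rfl fun z _ => ?_
      by_cases h1 : X (sourceOf hn (z + d)) = a <;> by_cases h2 : X (sourceOf hn z) = b <;>
        simp [h1, h2]
    rw [hcount]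
    refine le_trans ?_ (neg_abs_le _ |> neg_le.mp)
    linarith
  · ring_nf

/-! ### Choice of the constants -/

lemma exists_small_error {k : ℕ} {ρ g : ℝ} (hg : 0 < g) :
    ∃ ε : ℝ, 0 < ε ∧ k * ε / 2 + 2 * (4 * k * ε / ρ + 2 * k * √(2 * k * ε)) < g := by
  have hcont : Continuous fun ε : ℝ =>
      k * ε / 2 + 2 * (4 * k * ε / ρ + 2 * k * √(2 * k * ε)) := by fun_prop
  have h := hcont.tendsto 0
  simp only [mul_zero, zero_div, Real.sqrt_zero, add_zero] at h
  have h2 := ((h.eventually (gt_mem_nhds hg)).filter_mono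
    (nhdsWithin_le_nhds (s := Set.Ioi 0))).and self_mem_nhdsWithin
  obtain ⟨ε, h3, h4⟩ := h2.exists
  exact ⟨ε, h4, h3⟩

/-- Half of the exponent absorbs the linear factor of the union bound: the quadratic term δ² n² / 8
of exp (δ n / 2) outgrows C n. -/
lemma exists_mul_exp_le {δ : ℝ} (hδ : 0 < δ) (C : ℝ) :
    ∃ N : ℕ, ∀ n : ℕ, N ≤ n → C * n * Real.exp (-(δ * n)) ≤ Real.exp (-(δ / 2) * n) := by
  obtain ⟨N, hN⟩ := exists_nat_ge (8 * C / δ ^ 2)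
  refine ⟨N, fun n hn => ?_⟩
  have hn' : 8 * C / δ ^ 2 ≤ n := hN.trans (by exact_mod_cast hn)
  rw [div_le_iff₀ (by positivity)] at hn'
  have h1 := Real.quadratic_le_exp_of_nonneg (x := δ / 2 * n) (by positivity)
  have h2 : C * n ≤ Real.exp (δ / 2 * n) := by
    refine le_trans ?_ h1
    have := mul_le_mul_of_nonneg_right hn' (by positivity : (0 : ℝ) ≤ n)
    have : 0 ≤ δ / 2 * n := by positivity
    nlinarith
  have h3 := mul_le_mul_of_nonneg_right h2 (Real.exp_nonneg (-(δ * n)))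
  refine h3.trans_eq ?_
  rw [← Real.exp_add]
  ring_nf

/-- The first loop makes at most k ε n / 2 moves. The second starts with deviation at most 2 k ε n²,
half of it present initially and half caused by the moves. With H = ρ n / 2 the total cost, divided
by n, is the left side of `hε`. -/
lemma Succeeds.of_concentrated {α : Fin k → ℚ} (hα : ∑ j, (α j : ℝ) = 1) (hm : IsMember α n)
    {ρ ε g : ℝ} (hρ : 0 < ρ)
    (hε : k * ε / 2 + 2 * (4 * k * ε / ρ + 2 * k * √(2 * k * ε)) < g)
    {h : ℕ} (hh : 1 ≤ h) (hhn : ρ * n / 2 ≤ 2 * h) {χ : ℕ → Fin k}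
    (hp : HasManyPairs n h (g * n) χ)
    (hcard : ∀ j, |((parts n χ j).card : ℝ) - (α j : ℝ) * n| ≤ ε * n)
    (hsum : ∀ j, |setSum (parts n χ j) - targetSum n k| ≤ ε * n ^ 2) :
    Succeeds α n (.sizing (parts n χ)) := by
  have hn : (0 : ℝ) < n := by exact_mod_cast hm.pos
  have hF : sizeDeviation α n χ ≤ k * (ε * n) := by
    refine (Finset.sum_le_sum fun j _ => hcard j).trans_eq ?_
    simp
  have hE : sumDeviation n χ ≤ k * (ε * n ^ 2) := by
    refine (Finset.sum_le_sum fun j _ => hsum j).trans_eq ?_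
    simp
  obtain ⟨N, hN⟩ := exists_nat_ge (sizeDeviation α n χ)
  refine .sizing hα hm hh (H := ρ * n / 2) (by positivity) hhn hp
    (a := k * ε * n / 2) (b := 2 * k * ε * n ^ 2) ?_ N χ hN ?_ ?_
  · have e1 : √(2 * k * ε * (n : ℝ) ^ 2) = √(2 * k * ε) * n := by
      rw [Real.sqrt_mul' _ (sq_nonneg _), Real.sqrt_sq hn.le]
    have e2 : k * ε * n / 2 + 2 * exchangeBudget k (ρ * n / 2) (2 * k * ε * n ^ 2) =
        (k * ε / 2 + 2 * (4 * k * ε / ρ + 2 * k * √(2 * k * ε))) * n := by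
      rw [exchangeBudget, e1]
      field_simp
      ring
    rw [e2]
    exact mul_lt_mul_of_pos_right hε hn
  · rw [changes_self, Nat.cast_zero]
    linarith
  · have := mul_le_mul_of_nonneg_left hF hn.le
    linarith

end EqualSumPartition
-- The union bound
namespace EqualSumPartition

open MeasureTheory ProbabilityTheory

variable {n k : ℕ}

lemma eighth_le_card_lowerElements {ρ : ℝ} (hn : 4 ≤ ρ * n) {d : ℕ} (hd : 1 ≤ d)
    (hd' : d ≤ ⌊ρ * n⌋₊ / 2) : ρ * n / 8 ≤ ((lowerElements ⌊ρ * n⌋₊ d).card : ℝ) := by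
  have h1 := le_two_mul_card_lowerElements (R := ⌊ρ * n⌋₊) hd
  have h2 : ⌊ρ * n⌋₊ ≤ 4 * (lowerElements ⌊ρ * n⌋₊ d).card := by omega
  have h3 : (⌊ρ * n⌋₊ : ℝ) ≤ 4 * (lowerElements ⌊ρ * n⌋₊ d).card := by exact_mod_cast h2
  have h4 := Nat.lt_floor_add_one (ρ * n)
  linarith

/-- The random choices for which a part has a wrong size or sum, or for which some pair count is
small. -/
def atypicalEvent (α : Fin k → ℚ) (hn : 0 < n) (ε c : ℝ) (R h : ℕ) :
    Fin k ⊕ Fin k ⊕ (Fin h × Fin k × Fin k) → Set (Fin n → Fin k)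
  | .inl j => {X | ε * n ≤
      |((parts n (fun z => X (sourceOf hn z)) j).card : ℝ) - (α j : ℝ) * n|}
  | .inr (.inl j) => {X | ε * n ^ 2 ≤
      |setSum (parts n (fun z => X (sourceOf hn z)) j) - targetSum n k|}
  | .inr (.inr (d, a, b)) => {X | pairCount hn R (d + 1) X a b ≤
      c ^ 2 / 2 * (lowerElements R (d + 1)).card}

/-- The rate 2 ε² comes from sizes and sums; the rate c⁴ ρ / 16 = (c⁴ / 2) (ρ / 8) comes from at
least ρ n / 8 pairs. -/
lemma measure_atypicalEvent_le [NeZero k] {α : Fin k → ℚ} (hn : 0 < n) {x : Fin n → Fin k → ℝ}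
    {ρ c ε δ : ℝ} (hx : IsPositiveSolution (partitionProblem α n) (ρ * n) c x) (hc : 0 ≤ c)
    (hρ1 : ρ ≤ 1) (hε : 0 ≤ ε) (hρn : 4 ≤ ρ * n) (hδε : δ ≤ 2 * ε ^ 2)
    (hδc : δ ≤ c ^ 4 * ρ / 16) (i) :
    (roundingLaw x).real (atypicalEvent α hn ε c ⌊ρ * n⌋₊ (⌊ρ * n⌋₊ / 2) i) ≤
      2 * Real.exp (-(δ * n)) := by
  have hn' : (0 : ℝ) < n := by exact_mod_cast hn
  have hprob := isProbabilityMeasure_choiceLaw hx.nonneg hx.row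
  have : IsProbabilityMeasure (roundingLaw x) :=
    inferInstanceAs (IsProbabilityMeasure (Measure.pi (choiceLaw x)))
  have hexp : 2 * Real.exp (-(2 * ε ^ 2 * n)) ≤ 2 * Real.exp (-(δ * n)) := by
    gcongr
  rcases i with j | j | ⟨d, a, b⟩
  · refine le_trans (le_of_eq ?_) ((measure_weighted_ge_le hx.nonneg hx.row
      (w := fun _ => 1) (fun _ => by simp) j hε).trans hexp)
    have hv := hx.volume j
    simp only [partitionProblem, mul_one] at hv
    simp only [atypicalEvent, one_mul, hv, card_parts_sourceOf]
  · refine (measureReal_mono fun X hX => ?_).trans ((measure_weighted_ge_le hx.nonneg hx.row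
      (w := fun i => ((n : ℝ) - i.val) / n) (fun i => ?_) j hε).trans hexp)
    · have hb := hx.mass j
      simp only [partitionProblem] at hb
      have hw : ∑ i : Fin n, ((n : ℝ) - i.val) / n * x i j = targetSum n k / n := by
        rw [← hb, Finset.sum_div]
        exact Finset.sum_congr rfl fun i _ => by ring
      simp only [atypicalEvent, Set.mem_ofPred_eq, setSum_parts_sourceOf] at hX ⊢
      rw [hw]
      have e : n * (∑ i, if X i = j then ((n : ℝ) - i.val) / n else 0) - targetSum n k =
          n * ((∑ i, if X i = j then ((n : ℝ) - i.val) / n else 0) - targetSum n k / n) := by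
        field_simp
      rw [e, abs_mul, abs_of_pos hn', sq] at hX
      refine le_of_mul_le_mul_left ?_ hn'
      linarith
    · have : (i.val : ℝ) ≤ n := by exact_mod_cast i.isLt.le
      refine ⟨div_nonneg (by linarith) hn'.le, (div_le_one hn').mpr ?_⟩
      linarith [(Nat.cast_nonneg i.val : (0 : ℝ) ≤ i.val)]
  · have hRn : ⌊ρ * n⌋₊ ≤ n := Nat.floor_le_of_le (by nlinarith)
    refine (measure_pairCount_le hn hRn (Nat.succ_pos d) hx.nonneg hx.row hc
      (fun i j hi => hx.lower i j ?_) a b).trans ?_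
    · have h1 : ((n - i.val : ℕ) : ℝ) ≤ ⌊ρ * n⌋₊ := by exact_mod_cast hi
      rw [Nat.cast_sub i.isLt.le] at h1
      exact h1.trans (Nat.floor_le (by positivity))
    · have h1 := eighth_le_card_lowerElements hρn (Nat.succ_pos d) (Nat.succ_le_of_lt d.isLt)
      have h2 : δ * n ≤ c ^ 4 / 2 * (lowerElements ⌊ρ * n⌋₊ (d + 1)).card := by
        have := mul_le_mul_of_nonneg_right hδc hn'.le
        have := mul_le_mul_of_nonneg_left h1 (by positivity : 0 ≤ c ^ 4 / 2)
        linarith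
      gcongr

lemma failureEvent_subset {α : Fin k → ℚ} (hα : ∑ j, (α j : ℝ) = 1) (hm : IsMember α n)
    {ρ ε c : ℝ} (hρ : 0 < ρ) (hρ1 : ρ ≤ 1) (hρn : 4 ≤ ρ * n)
    (hε : k * ε / 2 + 2 * (4 * k * ε / ρ + 2 * k * √(2 * k * ε)) < c ^ 2 * ρ / 16) :
    failureEvent α n ⊆
      ⋃ i, atypicalEvent α hm.pos ε c ⌊ρ * n⌋₊ (⌊ρ * n⌋₊ / 2) i := by
  intro X hX
  by_contra hcon
  rw [Set.mem_iUnion] at hcon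
  push Not at hcon
  refine hX ?_
  have hn' : (0 : ℝ) < n := by exact_mod_cast hm.pos
  have hR := Nat.lt_floor_add_one (ρ * n)
  have hR4 : 4 ≤ ⌊ρ * n⌋₊ := Nat.le_floor (by exact_mod_cast hρn)
  rw [initialSets_eq_parts hm.pos]
  refine .of_concentrated hα hm hρ hε (h := ⌊ρ * n⌋₊ / 2) (by omega) ?_ ?_ (fun j => ?_)
    fun j => ?_
  -- Here ρ n ≥ 4 is used: 2 h ≥ ⌊ρ n⌋ - 1 > ρ n - 2 ≥ ρ n / 2.
  · have : ⌊ρ * n⌋₊ ≤ 2 * (⌊ρ * n⌋₊ / 2) + 1 := by omega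
    have : (⌊ρ * n⌋₊ : ℝ) ≤ 2 * ((⌊ρ * n⌋₊ / 2 : ℕ) : ℝ) + 1 := by exact_mod_cast this
    linarith
  · refine hasManyPairs_of_pairCount hm.pos (Nat.floor_le_of_le (by nlinarith))
      (Nat.div_le_self _ _) fun d a b h1 h2 => ?_
    have h3 := hcon (.inr (.inr (⟨d - 1, by omega⟩, a, b)))
    simp only [atypicalEvent, Set.mem_ofPred_eq, Nat.sub_add_cancel h1, not_le] at h3
    have h4 := eighth_le_card_lowerElements hρn h1 h2
    have := mul_le_mul_of_nonneg_left h4 (by positivity : 0 ≤ c ^ 2 / 2)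
    linarith
  · have := hcon (.inl j)
    simp only [atypicalEvent, Set.mem_ofPred_eq, not_le] at this
    exact this.le
  · have := hcon (.inr (.inl j))
    simp only [atypicalEvent, Set.mem_ofPred_eq, not_le] at this
    exact this.le

end EqualSumPartition

open EqualSumPartition in
theorem theorem3 (k : ℕ) (α : Fin k → ℚ) (hα : IsLinearFamily α) :
    ∃ δ : ℝ, 0 < δ ∧ ∃ N : ℕ, ∀ n : ℕ, N ≤ n → IsMember α n →
      ∃ x : Fin n → Fin k → ℝ,
        FluidMixingReturns (partitionProblem α n) x ∧
        (∀ i j, 0 ≤ x i j) ∧ (∀ i, ∑ j, x i j = 1) ∧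
        (roundingLaw x).real (failureEvent α n) ≤ Real.exp (-δ * (n : ℝ)) := by
  obtain ⟨c, ρ, hc, hρ, hρ1, N₁, hsol⟩ := hα.exists_positiveSolution
  have hk : k ≠ 0 := by
    rintro rfl
    exact absurd hα.sum_eq_one (by simp)
  have : NeZero k := ⟨hk⟩
  have hk1 : (1 : ℝ) ≤ k := by exact_mod_cast Nat.one_le_iff_ne_zero.mpr hk
  obtain ⟨ε, hε, hεg⟩ := exists_small_error (k := k) (ρ := ρ) (g := c ^ 2 * ρ / 16)
    (by positivity)
  set δ := min (2 * ε ^ 2) (c ^ 4 * ρ / 16) with hδ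
  have hδ0 : 0 < δ := lt_min (by positivity) (by positivity)
  -- There are at most 2 k + n k² ≤ 3 k² n atypical events, each of probability at most 2 exp (-δ
  -- n).
  obtain ⟨N₂, hN₂⟩ := exists_mul_exp_le hδ0 (6 * k ^ 2)
  obtain ⟨N₃, hN₃⟩ := exists_nat_ge (4 / ρ)
  refine ⟨δ / 2, by positivity, max N₁ (max N₂ N₃), fun n hn hm => ?_⟩
  simp only [max_le_iff] at hn
  obtain ⟨x, hret, hx⟩ := hsol n hn.1 hm
  refine ⟨x, hret, hx.nonneg, hx.row, ?_⟩
  have hρn : 4 ≤ ρ * n := by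
    have : 4 / ρ ≤ n := hN₃.trans (by exact_mod_cast hn.2.2)
    rw [div_le_iff₀ hρ] at this
    linarith
  have hprob := isProbabilityMeasure_choiceLaw hx.nonneg hx.row
  have : MeasureTheory.IsProbabilityMeasure (roundingLaw x) :=
    inferInstanceAs (MeasureTheory.IsProbabilityMeasure (MeasureTheory.Measure.pi (choiceLaw x)))
  refine (MeasureTheory.measureReal_mono
    (failureEvent_subset hα.sum_real hm hρ hρ1 hρn hεg)).trans ?_
  refine (MeasureTheory.measureReal_iUnion_fintype_le _).trans ?_
  refine (Finset.sum_le_sum fun i _ => measure_atypicalEvent_le hm.pos hx hc.le hρ1 hε.le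
    hρn (min_le_left _ _) (min_le_right _ _) i).trans ?_
  refine le_trans ?_ (hN₂ n hn.2.1)
  simp only [Finset.sum_const, Finset.card_univ, Fintype.card_sum, Fintype.card_prod,
    Fintype.card_fin, nsmul_eq_mul]
  push_cast
  rw [← mul_assoc]
  refine mul_le_mul_of_nonneg_right ?_ (Real.exp_nonneg _)
  have hn1 : (1 : ℝ) ≤ n := by exact_mod_cast hm.pos
  have hh : ((⌊ρ * n⌋₊ / 2 : ℕ) : ℝ) ≤ n := by
    exact_mod_cast (Nat.div_le_self _ _).trans (Nat.floor_le_of_le (by nlinarith))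
  have h1 : ((⌊ρ * n⌋₊ / 2 : ℕ) : ℝ) * (k * k) ≤ n * (k * k) := by gcongr
  have h2 : (k : ℝ) ≤ n * (k * k) := by nlinarith [mul_le_mul hn1 hk1 zero_le_one (by linarith)]
  nlinarith
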